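/- Let $N\ge 1$ and $W_n=\{x\in\mathbb Z^n : x_1<\dots<x_n\}$, $\Delta_n(x)=\prod_{1\le i<j\le n}(x_j-x_i)$. For $y\in\mathbb Z^{n}$ and $x\in\mathbb Z^{n+1}$ write $y\prec x$ if $x_1<y_1\le x_2<y_2\le\dots<y_n\le x_{n+1}$, and let $GT_N$ be the set of Gelfand–Tsetlin patterns $X=(x^1,\dots,x^N)$, $x^n=(x^n_1,\dots,x^n_n)\in\mathbb Z^n$, $x^1\prec x^2\prec\dots\prec x^N$. For $p\in[0,1]$ let $P(u,v)=p\,\mathbf 1_{v=u+1}+(1-p)\,\mathbf 1_{v=u}$ on $\mathbb Z$, let $$P_n(x,y)=\frac{\Delta_n(y)}{\Delta_n(x)}\det\big(P(x_i,y_j)\big)_{i,j=1}^n\quad(x,y\in W_n)$$ (the discrete-time analogue of the Charlier process), let $$\Lambda^n_{n-1}(x,y)=(n-1)!\,\frac{\Delta_{n-1}(y)}{\Delta_n(x)}\mathbf 1_{y\prec x}\quad(x\in W_n,\ y\in W_{n-1}),\qquad \Delta^n_{n-1}=P_n\Lambda^n_{n-1},$$ and define the intertwined discrete-time chain on $GT_N$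 by $$P_\Lambda(X,Y)=P_1(x^1,y^1)\prod_{k=2}^N\frac{P_k(x^k,y^k)\,\Lambda^k_{k-1}(y^k,y^{k-1})}{\Delta^k_{k-1}(x^k,y^{k-1})}$$ if $\prod_{k=2}^N\Delta^k_{k-1}(x^k,y^{k-1})>0$, and $P_\Lambda(X,Y)=0$ otherwise. Let $\pi(X)=(x^1_1,x^2_1,\dots,x^N_1)$ be the projection onto the leftmost particles; its values lie in $\{z\in\mathbb Z^N: z_1>z_2>\dots>z_N\}$. Discrete-time TASEP with sequential update is the chain on $\{z_1>\dots>z_N\}$ with one-step matrix $T_p$ in which the particles $1,2,\dots,N$ are updated in this order, each one jumping one site to the right with probability $p$ and staying with probability $1-p$, except that particle $n\ge2$ stays put if the site to its right is occupied by the already updated particle $n-1$. Continuous-time TASEP with $N$ particles has transition probabilities $Q_t(x,y)=(e^{tL}\mathbf 1_{\{y\}})(x)$, where $(Lf)(x)=\sum_{n}\mathbf 1[\text{the site } x_n+1 \text{ is empty}]\,(f(x+e_n)-f(x))$. 1. For every $p\in[0,1]$, $P_\Lambda$ and $T_p$ are stochastic matrices, and $\sum_{Y:\pi(Y)=y}P_\Lambda(X,Y)=T_p(\pi(X),y)$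 for all $X\in GT_N$ and all $y$. If $(X(k))_{k\ge0}$ is a Markov chain on $GT_N$ with transition matrix $P_\Lambda$ and any initial law, then $(\pi(X(k)))_{k\ge0}$ is a Markov chain with transition matrix $T_p$. 2. For all $t\ge0$ and all states, the limits $$R_t(X,Y)=\lim_{p\downarrow0}(P_\Lambda)^{\lfloor t/p\rfloor}(X,Y),\qquad \lim_{p\downarrow0}(T_p)^{\lfloor t/p\rfloor}(x,y)=Q_t(x,y)$$ exist, the second one having the stated value. Both $R_t$ (the continuous-time intertwined chain on $GT_N$) and $Q_t$ are transition functions of continuous-time Markov chains: stochastic matrices, equal to the identity at $t=0$, satisfying the Chapman–Kolmogorov equations, and with diagonal entries tending to $1$ as $t\downarrow0$. 3. For all $t\ge0$, $X\in GT_N$ and $y$ one has $\sum_{Y:\pi(Y)=y}R_t(X,Y)=Q_t(\pi(X),y)$. If $(X(t))_{t\ge0}$ is a Markov chain on $GT_N$ with transition function $R_t$ and any initial law, then its projection $(x^1_1(t),\dots,x^N_1(t))_{t\ge0}$ is again a Markov chain, namely continuous-time TASEP with $N$ particles, i.e. the Markov chain with transition function $Q_t$; and the path of the projection is right-continuous with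 left limits whenever the path of $X$ is. -/

import Mathlib

open Filter Topology MeasureTheory
open scoped NNReal

noncomputable section

namespace GTTasep

/-! ### Markov chains on countable state spaces -/

section Markov

variable {S S' T : Type*}

/-- A stochastic matrix: nonnegative entries, all rows sum to one. -/
structure IsStochastic (K : S → S → ℝ) : Prop where
  nonneg : ∀ x y, 0 ≤ K x y
  hasSum_one : ∀ x, HasSum (K x) 1

open Classical in
/-- The powers `K ^ n` of a matrix indexed by `S` (the `n`-step transition probabilities). -/
def kernelPow (K : S → S → ℝ) : ℕ → S → S → ℝ
  | 0 => fun x y => if x = y then 1 else 0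
  | n + 1 => fun x y => ∑' z, kernelPow K n x z * K z y

open Classical in
/-- A (standard, honest) continuous-time transition function: each `P t` is a stochastic matrix,
`P 0` is the identity, the Chapman-Kolmogorov equations hold, and `P t x x → 1` as `t ↓ 0`. -/
structure IsTransitionFunction (P : ℝ≥0 → S → S → ℝ) : Prop where
  stochastic : ∀ t, IsStochastic (P t)
  zero : ∀ x y, P 0 x y = if x = y then 1 else 0
  chapman_kolmogorov : ∀ s t x y, HasSum (fun z => P s x z * P t z y) (P (s + t) x y)
  standard : ∀ x, Tendsto (fun t => P t x x) (𝓝[>] 0) (𝓝 1)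

/-- `X` is, under `μ`, a time-homogeneous Markov chain (with an arbitrary initial law) with values
in the countable set `S`, with time set `T` (`ℕ` or `ℝ≥0`), and with transition probabilities
`P t x y` from `x` to `y` in time `t`: for all times `t₀ < ⋯ < tₘ` and states `s₀, …, sₘ`,
`μ(X_{t₀} = s₀, …, X_{tₘ} = sₘ) = μ(X_{t₀} = s₀) ∏ᵢ P_{tᵢ₊₁ - tᵢ}(sᵢ, sᵢ₊₁)`. -/
structure IsMarkovChain [LinearOrder T] [Sub T] {Ω : Type*} [MeasurableSpace Ω] (μ : Measure Ω)
    (P : T → S → S → ℝ) (X : T → Ω → S) : Prop where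
  measurableSet_eq : ∀ t s, MeasurableSet {ω | X t ω = s}
  joint_law : ∀ (m : ℕ) (t : Fin (m + 1) → T) (s : Fin (m + 1) → S), StrictMono t →
    μ.real {ω | ∀ i, X (t i) ω = s i} =
      μ.real {ω | X (t 0) ω = s 0} *
        ∏ i : Fin m, P (t i.succ - t i.castSucc) (s i.castSucc) (s i.succ)

/-- A path in a discrete space which is right-continuous and has left limits. -/
def IsCadlagPath (x : ℝ≥0 → S) : Prop :=
  (∀ t, ∀ᶠ s in 𝓝[>] t, x s = x t) ∧ ∀ t, 0 < t → ∃ a, ∀ᶠ s in 𝓝[<] t, x s = a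

/-- Under the map `π`, the matrix `K` projects onto the matrix `K'`: from any `x`, the total
`K`-probability of the fibre of `π` over `y` is `K' (π x) y`. -/
def ProjectsTo (π : S → S') (K : S → S → ℝ) (K' : S' → S' → ℝ) : Prop :=
  ∀ x y, HasSum (fun z : {z : S // π z = y} => K x z) (K' (π x) y)

end Markov

/-! ### The one-level dynamics and the links -/

/-- The Vandermonde product `Δ_n(x) = ∏_{i < j} (x_j - x_i)`. -/
def vandermonde {n : ℕ} (x : Fin n → ℤ) : ℝ :=
  ∏ i, ∏ j ∈ Finset.Ioi i, ((x j : ℝ) - (x i : ℝ))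

/-- The one-particle step: jump one site to the right with probability `p`, else stay put. -/
def oneStep (p : ℝ) (x y : ℤ) : ℝ :=
  if y = x + 1 then p else if y = x then 1 - p else 0

/-- The one-step transition probability of the discrete-time Charlier process on
`W_n = {x ∈ ℤⁿ | x_1 < ⋯ < x_n}`: the `h`-transform `Δ_n(y)/Δ_n(x) · det(P(x_i, y_j))`. -/
def levelStep (p : ℝ) {n : ℕ} (x y : Fin n → ℤ) : ℝ :=
  vandermonde y / vandermonde x * (Matrix.of fun i j => oneStep p (x i) (y j)).det

/-- `y ≺ x`, i.e. `x_1 < y_1 ≤ x_2 < y_2 ≤ ⋯ < y_n ≤ x_{n+1}`. -/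
def Interlaces {n : ℕ} (y : Fin n → ℤ) (x : Fin (n + 1) → ℤ) : Prop :=
  ∀ i : Fin n, x i.castSucc < y i ∧ y i ≤ x i.succ

open Classical in
/-- The Markov link from level `n + 1` to level `n`: `n! · Δ_n(y)/Δ_{n+1}(x) · 1[y ≺ x]`. -/
def link {n : ℕ} (x : Fin (n + 1) → ℤ) (y : Fin n → ℤ) : ℝ :=
  if Interlaces y x then (n.factorial : ℝ) * (vandermonde y / vandermonde x) else 0

/-- The product of the level dynamics with the link: the sum over `z ∈ W_{n+1}` of the
probability of going from `x` to `z` on level `n + 1` and then from `z` to `y` by the link. -/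
def stepLink (p : ℝ) {n : ℕ} (x : Fin (n + 1) → ℤ) (y : Fin n → ℤ) : ℝ :=
  ∑' z : {z : Fin (n + 1) → ℤ // StrictMono z}, levelStep p x z * link z.1 y

/-! ### The chain on Gelfand-Tsetlin patterns -/

/-- Gelfand-Tsetlin patterns with `N` levels. The index `n : Fin N` stands for level `n + 1`, which
has the `n + 1` particles `X n 0 < ⋯ < X n n`. -/
def GT (N : ℕ) : Type :=
  {X : (n : Fin N) → Fin (n.1 + 1) → ℤ //
    ∀ (n : ℕ) (h : n + 1 < N), Interlaces (X ⟨n, Nat.lt_of_succ_lt h⟩) (X ⟨n + 1, h⟩)}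

/-- The normalizing constant on a level: `1` on the first level, and on each other one the
`stepLink` from the old state of the level to the new state of the level below. -/
def gtNorm {N : ℕ} (p : ℝ) (X Y : GT N) : Fin N → ℝ
  | ⟨0, _⟩ => 1
  | ⟨n + 1, h⟩ => stepLink p (X.1 ⟨n + 1, h⟩) (Y.1 ⟨n, Nat.lt_of_succ_lt h⟩)

/-- The conditional probability of the new state of a level, given its old state and
the new state of the level below. -/
def gtFactor {N : ℕ} (p : ℝ) (X Y : GT N) : Fin N → ℝ
  | ⟨0, h⟩ => levelStep p (X.1 ⟨0, h⟩) (Y.1 ⟨0, h⟩)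
  | ⟨n + 1, h⟩ =>
      levelStep p (X.1 ⟨n + 1, h⟩) (Y.1 ⟨n + 1, h⟩) *
        link (Y.1 ⟨n + 1, h⟩) (Y.1 ⟨n, Nat.lt_of_succ_lt h⟩) /
          stepLink p (X.1 ⟨n + 1, h⟩) (Y.1 ⟨n, Nat.lt_of_succ_lt h⟩)

open Classical in
/-- One step of the discrete-time intertwined chain on Gelfand-Tsetlin patterns. -/
def gtStep (N : ℕ) (p : ℝ) (X Y : GT N) : ℝ :=
  if 0 < ∏ n, gtNorm p X Y n then ∏ n, gtFactor p X Y n else 0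

/-- The transition probabilities of the continuous-time intertwined chain: the limit `p ↓ 0` of the
discrete-time chain after `⌊t/p⌋` steps. -/
def gtTransition (N : ℕ) (t : ℝ≥0) (X Y : GT N) : ℝ :=
  limUnder (𝓝[>] (0 : ℝ)) fun p => kernelPow (gtStep N p) ⌊(t : ℝ) / p⌋₊ X Y

/-! ### TASEP with `N` particles -/

/-- Configurations of `N` exclusion particles on `ℤ`, labelled from right to left. -/
def TasepState (N : ℕ) : Type := {x : Fin N → ℤ // StrictAnti x}

/-- The site to the right of particle `n` is empty. -/
def CanJump {N : ℕ} (x : TasepState N) (n : Fin N) : Prop := ∀ m, x.1 m ≠ x.1 n + 1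

/-- Particle `n` jumps one site to the right. -/
def jump {N : ℕ} (x : TasepState N) (n : Fin N) (h : CanJump x n) : TasepState N :=
  ⟨Function.update x.1 n (x.1 n + 1), by
    intro a b hab
    have hx := x.2 hab
    have ha := h a
    by_cases h1 : a = n
    · subst h1
      have h2 : b ≠ a := hab.ne'
      simp only [Function.update_self, Function.update_of_ne h2]
      omega
    · by_cases h2 : b = n
      · subst h2
        simp only [Function.update_self, Function.update_of_ne h1]
        omega
      · simpa only [Function.update_of_ne h1, Function.update_of_ne h2] using hx⟩

open Classical in
/-- The generator of TASEP: each particle jumps to the right at rate `1` if the target site is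
empty. -/
def tasepGenerator (N : ℕ) (f : TasepState N → ℝ) (x : TasepState N) : ℝ :=
  ∑ n, if h : CanJump x n then f (jump x n h) - f x else 0

open Classical in
/-- The transition probabilities `(exp(t L) 1_{y})(x)` of continuous-time TASEP, where `L` is the
generator (a bounded operator on bounded functions), by the exponential series. -/
def tasepTransition (N : ℕ) (t : ℝ≥0) (x y : TasepState N) : ℝ :=
  ∑' k : ℕ, (t : ℝ) ^ k / (k.factorial : ℝ) *
    ((tasepGenerator N)^[k] fun z => if z = y then 1 else 0) x

/-- The factor of a particle in a step of discrete-time TASEP with sequential update: the first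
particle is free; any other one stays put if the site to its right is occupied by the already
updated particle ahead of it, and makes a free step otherwise. -/
def seqTasepFactor {N : ℕ} (p : ℝ) (x y : TasepState N) : Fin N → ℝ
  | ⟨0, h⟩ => oneStep p (x.1 ⟨0, h⟩) (y.1 ⟨0, h⟩)
  | ⟨n + 1, h⟩ =>
      if x.1 ⟨n + 1, h⟩ + 1 = y.1 ⟨n, Nat.lt_of_succ_lt h⟩ then
        (if y.1 ⟨n + 1, h⟩ = x.1 ⟨n + 1, h⟩ then 1 else 0)
      else oneStep p (x.1 ⟨n + 1, h⟩) (y.1 ⟨n + 1, h⟩)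

/-- One step of discrete-time TASEP with sequential update and jump probability `p`. -/
def seqTasepStep (N : ℕ) (p : ℝ) (x y : TasepState N) : ℝ :=
  ∏ n, seqTasepFactor p x y n

/-! ### The projection -/

/-- The projection of a pattern onto the leftmost particles of all levels. -/
def leftmost {N : ℕ} (X : GT N) : TasepState N :=
  ⟨fun n => X.1 n 0, by
    cases N with
    | zero => exact fun a => a.elim0
    | succ N =>
      refine Fin.strictAnti_iff_succ_lt.2 fun i => ?_
      exact (X.2 i.1 (Nat.succ_lt_succ i.2) 0).1⟩

end GTTasep

end

noncomputable section

namespace GTTasep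

/-! ### Operators on `ℓ¹(S)` and their matrices -/

section L1

variable {S S₂ : Type*}

/-! Jumps have size at most one, so only the identity permutation survives in the determinant of
`levelStep` (`levelStep_eq`). In the product with the link the Vandermonde factor of the
intermediate state cancels, and interlacing with a fixed lower row is one constraint per particle.
Hence `stepLink` and the conditional law of each level factorize over particles: given the new row
below, a particle makes a free step conditioned to fit, that is, it is blocked, pushed or free
(`oneStep_div_fitProb`). The chain is thus a random mapping `gtUpdate` driven by one independent bit
per particle (`gtStep_eq_mapKernel`). A leftmost particle is never pushed, and is blocked exactly by
the rule of sequential TASEP, so `leftmost` commutes with the two updates driven by the same bits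
(`leftmost_gtUpdate`).

For continuous time, a random-mapping kernel is a contraction of `ℓ¹` when `p` lies in `[0,1]`, is
polynomial in `p`, and is the identity at `p = 0` for both updates. Euler's limit
`tendsto_pow_floor_div` gives convergence in operator norm to the exponential of its derivative at
`0`; stochasticity and intertwining are closed conditions and pass to the limit. To first order in
`p` only one bit fires, so the update order disappears and the derivative is the TASEP generator
(`tasepUpdate_singleBit_zero`, `mat_mapGen_pow`).

Because the kernels project from every single pattern, the Markov property passes to the image for
any initial law (`IsMarkovChain.project`). -/

/-- The Banach space `ℓ¹(S)` of summable signed measures on `S`. -/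
abbrev L1 (S : Type*) : Type _ := lp (fun _ : S => ℝ) 1

open Classical in
/-- The Dirac mass at `x`. -/
def dirac (x : S) : L1 S := lp.single 1 x 1

open Classical in
lemma dirac_apply (x y : S) : dirac x y = if x = y then 1 else 0 := by
  rw [dirac, lp.single_apply, Pi.single_apply]
  simp only [eq_comm]

lemma norm_dirac (x : S) : ‖dirac x‖ = 1 := by
  simp [dirac, lp.norm_single]

lemma L1.hasSum_norm (f : L1 S) : HasSum (fun x => ‖f x‖) ‖f‖ := by
  simpa using lp.hasSum_norm (p := 1) (by simp) f

lemma L1.hasSum_dirac (f : L1 S) : HasSum (fun x => f x • dirac x) f := by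
  classical
  have h := lp.hasSum_single (p := 1) (by simp) f
  convert h using 2 with x
  rw [dirac, ← lp.single_smul]
  congr 1
  simp

/-- Evaluation at a point. -/
def L1.eval (x : S) : L1 S →L[ℝ] ℝ := lp.evalCLM ℝ (fun _ : S => ℝ) 1 x

lemma L1.eval_apply (x : S) (f : L1 S) : L1.eval x f = f x := rfl

/-- Dirac masses have dense span, so operator identities such as intertwinings reduce to a check on
single states. -/
lemma L1.clm_ext {E : Type*} [NormedAddCommGroup E] [NormedSpace ℝ E] {A B : L1 S →L[ℝ] E}
    (h : ∀ x, A (dirac x) = B (dirac x)) : A = B := by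
  ext1 f
  have hA := (L1.hasSum_dirac f).mapL A
  have hB := (L1.hasSum_dirac f).mapL B
  simp only [map_smul, h] at hA hB
  exact hA.unique hB

/-- The continuous linear extension to `ℓ¹(S)` of a family of vectors in the unit ball. -/
def L1.lift {E : Type*} [NormedAddCommGroup E] [NormedSpace ℝ E] [CompleteSpace E] (v : S → E)
    (hv : ∀ x, ‖v x‖ ≤ 1) : L1 S →L[ℝ] E :=
  have hb : ∀ (f : L1 S) x, ‖f x • v x‖ ≤ ‖f x‖ := fun f x => by
    rw [norm_smul]; exact mul_le_of_le_one_right (norm_nonneg _) (hv x)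
  have hs : ∀ f : L1 S, Summable fun x => f x • v x := fun f =>
    Summable.of_norm_bounded (L1.hasSum_norm f).summable (hb f)
  LinearMap.mkContinuous
    { toFun := fun f => ∑' x, f x • v x
      map_add' := fun f g => by
        rw [← (hs f).tsum_add (hs g)]
        simp [add_smul]
      map_smul' := fun c f => by
        rw [RingHom.id_apply, ← (hs f).tsum_const_smul c]
        simp [smul_smul] } 1 fun f => by
    rw [one_mul]
    exact tsum_of_norm_bounded (L1.hasSum_norm f) (hb f)

section lift

variable {E : Type*} [NormedAddCommGroup E] [NormedSpace ℝ E] [CompleteSpace E] (v : S → E)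
  (hv : ∀ x, ‖v x‖ ≤ 1)

lemma L1.norm_lift_le : ‖L1.lift v hv‖ ≤ 1 :=
  LinearMap.mkContinuous_norm_le _ zero_le_one fun f => by
    exact (one_mul ‖f‖).symm ▸ tsum_of_norm_bounded (L1.hasSum_norm f) fun x => by
      rw [norm_smul]; exact mul_le_of_le_one_right (norm_nonneg _) (hv x)

lemma L1.lift_dirac (x : S) : L1.lift v hv (dirac x) = v x := by
  classical
  change ∑' y, dirac x y • v y = v x
  rw [tsum_eq_single x fun y hy => by simp [dirac_apply, hy.symm]]
  simp [dirac_apply]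

end lift

/-- The push-forward of measures. -/
def L1.map (φ : S → S₂) : L1 S →L[ℝ] L1 S₂ :=
  L1.lift (fun x => dirac (φ x)) fun _ => (norm_dirac _).le

lemma L1.map_dirac (φ : S → S₂) (x : S) : L1.map φ (dirac x) = dirac (φ x) := L1.lift_dirac _ _ x

lemma L1.norm_map_le (φ : S → S₂) : ‖L1.map φ‖ ≤ 1 := L1.norm_lift_le _ _

/-- The total mass. -/
def L1.mass : L1 S →L[ℝ] ℝ := L1.lift (fun _ => 1) (by simp)

lemma L1.mass_dirac (x : S) : L1.mass (dirac x) = 1 := L1.lift_dirac _ _ x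

lemma L1.hasSum_mass (f : L1 S) : HasSum (fun x => f x) (L1.mass f) := by
  have h := (L1.hasSum_dirac f).mapL L1.mass
  simpa [L1.mass_dirac] using h

lemma L1.hasSum_map (φ : S → S₂) (f : L1 S) (y : S₂) :
    HasSum (fun x : {x : S // φ x = y} => f x) (L1.map φ f y) := by
  classical
  have h := ((L1.hasSum_dirac f).mapL (L1.map φ)).mapL (L1.eval y)
  change HasSum ((fun x => f x) ∘ ((↑) : {x : S | φ x = y} → S)) (L1.eval y (L1.map φ f))
  rw [hasSum_subtype_iff_indicator]
  convert h using 2 with x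
  simp only [map_smul, L1.map_dirac, L1.eval_apply, dirac_apply, Set.indicator_apply,
    Set.mem_ofPred_eq, smul_eq_mul, mul_ite, mul_one, mul_zero]

/-- The matrix of an operator on `ℓ¹(S)`; measures are row vectors. -/
def mat (A : L1 S →L[ℝ] L1 S) (x y : S) : ℝ := A (dirac x) y

lemma continuous_mat (x y : S) : Continuous fun A : L1 S →L[ℝ] L1 S => mat A x y :=
  (L1.eval y).continuous.comp
    (ContinuousLinearMap.apply ℝ (L1 S) (dirac x)).continuous

open Classical in
lemma mat_one (x y : S) : mat 1 x y = if x = y then 1 else 0 := dirac_apply x y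

/-- Operators act on measures from the left while matrices act on row vectors from the right, hence
the reversed order of the factors. -/
lemma hasSum_mat_mul (A B : L1 S →L[ℝ] L1 S) (x y : S) :
    HasSum (fun z => mat A x z * mat B z y) (mat (B * A) x y) := by
  have h := ((L1.hasSum_dirac (A (dirac x))).mapL B).mapL (L1.eval y)
  simpa [mat, L1.eval_apply] using h

lemma kernelPow_mat (A : L1 S →L[ℝ] L1 S) (n : ℕ) : kernelPow (mat A) n = mat (A ^ n) := by
  induction n with
  | zero => funext x y; simp [kernelPow, mat_one]
  | succ n ih =>
    funext x y
    simp only [kernelPow]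
    rw [ih, pow_succ', (hasSum_mat_mul _ _ x y).tsum_eq]

/-- An operator on `ℓ¹(S)` which preserves positivity of Dirac masses and the total mass. -/
structure IsStochasticOp (A : L1 S →L[ℝ] L1 S) : Prop where
  nonneg : ∀ x y, 0 ≤ mat A x y
  mass : L1.mass ∘L A = L1.mass

lemma IsStochasticOp.isStochastic {A : L1 S →L[ℝ] L1 S} (h : IsStochasticOp A) :
    IsStochastic (mat A) where
  nonneg := h.nonneg
  hasSum_one x := by
    have := L1.hasSum_mass (A (dirac x))
    rwa [← ContinuousLinearMap.comp_apply, h.mass, L1.mass_dirac] at this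

lemma IsStochasticOp.one : IsStochasticOp (1 : L1 S →L[ℝ] L1 S) where
  nonneg x y := by rw [mat_one]; split_ifs <;> norm_num
  mass := rfl

lemma IsStochasticOp.mul {A B : L1 S →L[ℝ] L1 S} (hA : IsStochasticOp A) (hB : IsStochasticOp B) :
    IsStochasticOp (A * B) where
  nonneg x y := (hasSum_mat_mul B A x y).nonneg fun z => mul_nonneg (hB.nonneg _ _) (hA.nonneg _ _)
  mass := by
    rw [ContinuousLinearMap.mul_def, ← ContinuousLinearMap.comp_assoc, hA.mass, hB.mass]

lemma IsStochasticOp.pow {A : L1 S →L[ℝ] L1 S} (hA : IsStochasticOp A) (n : ℕ) :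
    IsStochasticOp (A ^ n) := by
  induction n with
  | zero => exact .one
  | succ n ih => exact pow_succ A n ▸ ih.mul hA

/-- Matrix entries and total mass depend continuously on the operator. This yields stochasticity of
the exponential semigroups without examining their generators. -/
lemma IsStochasticOp.of_tendsto {ι : Type*} {l : Filter ι} [l.NeBot] {A : ι → L1 S →L[ℝ] L1 S}
    {B : L1 S →L[ℝ] L1 S} (hA : ∀ᶠ i in l, IsStochasticOp (A i)) (h : Tendsto A l (𝓝 B)) :
    IsStochasticOp B where
  nonneg x y := ge_of_tendsto (((continuous_mat x y).tendsto B).comp h)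
    (hA.mono fun i hi => hi.nonneg x y)
  mass := by
    refine tendsto_nhds_unique_of_eventuallyEq
      (((ContinuousLinearMap.compL ℝ (L1 S) (L1 S) ℝ L1.mass).continuous.tendsto B).comp h)
      tendsto_const_nhds (hA.mono fun i hi => hi.mass)

lemma projectsTo_mat {φ : S → S₂} {A : L1 S →L[ℝ] L1 S} {B : L1 S₂ →L[ℝ] L1 S₂}
    (h : L1.map φ ∘L A = B ∘L L1.map φ) : ProjectsTo φ (mat A) (mat B) := fun x y => by
  have := L1.hasSum_map φ (A (dirac x)) y
  rwa [← ContinuousLinearMap.comp_apply, h, ContinuousLinearMap.comp_apply, L1.map_dirac] at this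

lemma map_comp_pow {φ : S → S₂} {A : L1 S →L[ℝ] L1 S} {B : L1 S₂ →L[ℝ] L1 S₂}
    (h : L1.map φ ∘L A = B ∘L L1.map φ) (n : ℕ) : L1.map φ ∘L (A ^ n) = (B ^ n) ∘L L1.map φ := by
  induction n with
  | zero => rfl
  | succ n ih =>
    rw [pow_succ, pow_succ, ContinuousLinearMap.mul_def, ContinuousLinearMap.mul_def,
      ← ContinuousLinearMap.comp_assoc, ih, ContinuousLinearMap.comp_assoc, h,
      ContinuousLinearMap.comp_assoc]

end L1

/-! ### The exponential limit in a Banach algebra -/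

section ExpLimit

variable {𝔸 : Type*} [NormedRing 𝔸]

/-- Telescoping. Only `a` has to be a contraction; for `b` bounded powers suffice, which suits `b =
exp (p • L)` with an arbitrary `L`. -/
lemma norm_pow_sub_pow_le {a b : 𝔸} {C : ℝ} (ha : ‖a‖ ≤ 1) (n : ℕ)
    (hb : ∀ k ≤ n, ‖b ^ k‖ ≤ C) : ‖a ^ n - b ^ n‖ ≤ n * ‖a - b‖ * C := by
  induction n with
  | zero => simp
  | succ n ih =>
    have h : a ^ (n + 1) - b ^ (n + 1) = a * (a ^ n - b ^ n) + (a - b) * b ^ n := by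
      rw [pow_succ', pow_succ']; noncomm_ring
    calc ‖a ^ (n + 1) - b ^ (n + 1)‖ ≤ ‖a‖ * ‖a ^ n - b ^ n‖ + ‖a - b‖ * ‖b ^ n‖ := by
          rw [h]; exact (norm_add_le _ _).trans (add_le_add (norm_mul_le _ _) (norm_mul_le _ _))
      _ ≤ 1 * (n * ‖a - b‖ * C) + ‖a - b‖ * C := by
          gcongr
          · exact ih fun k hk => hb k (by omega)
          · exact hb n (by omega)
      _ = (n + 1 : ℕ) * ‖a - b‖ * C := by push_cast; ring

variable [NormedAlgebra ℝ 𝔸] [CompleteSpace 𝔸]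

lemma exp_smul_pow (L : 𝔸) (p : ℝ) (n : ℕ) :
    NormedSpace.exp (p • L) ^ n = NormedSpace.exp ((n * p : ℝ) • L) := by
  let : NormedAlgebra ℚ 𝔸 := .restrictScalars ℚ ℝ 𝔸
  rw [← NormedSpace.exp_nsmul, ← Nat.cast_smul_eq_nsmul ℝ, smul_smul]

lemma continuous_exp_smul (L : 𝔸) : Continuous fun t : ℝ => NormedSpace.exp (t • L) :=
  continuous_iff_continuousAt.2 fun t => (hasDerivAt_exp_smul_const L t).continuousAt

lemma exp_add_smul (L : 𝔸) (s t : ℝ) :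
    NormedSpace.exp ((s + t) • L) = NormedSpace.exp (t • L) * NormedSpace.exp (s • L) := by
  let : NormedAlgebra ℚ 𝔸 := .restrictScalars ℚ ℝ 𝔸
  rw [add_comm s t, add_smul, NormedSpace.exp_add_of_commute]
  exact ((Commute.refl L).smul_left t).smul_right s

lemma tendsto_floor_div_mul (t : ℝ≥0) :
    Tendsto (fun p : ℝ => ⌊(t : ℝ) / p⌋₊ * p) (𝓝[>] 0) (𝓝 t) := by
  have h0 : Tendsto (fun p : ℝ => (t : ℝ) - p) (𝓝[>] 0) (𝓝 t) := by
    have : Tendsto (fun p : ℝ => (t : ℝ) - p) (𝓝 0) (𝓝 (t - 0)) :=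
      (continuous_const.sub continuous_id).tendsto 0
    rw [sub_zero] at this
    exact this.mono_left nhdsWithin_le_nhds
  refine tendsto_of_tendsto_of_tendsto_of_le_of_le' h0 tendsto_const_nhds ?_ ?_
  · filter_upwards [self_mem_nhdsWithin] with p hp
    have hp : 0 < p := hp
    have := Nat.lt_floor_add_one ((t : ℝ) / p)
    rw [div_lt_iff₀ hp] at this
    linarith
  · filter_upwards [self_mem_nhdsWithin] with p hp
    have hp : 0 < p := hp
    rw [← le_div_iff₀ hp]
    exact Nat.floor_le (by positivity)

/-- Euler's limit for a differentiable family of contractions through the identity. -/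
theorem tendsto_pow_floor_div {K : ℝ → 𝔸} {L : 𝔸} (hK : ∀ᶠ p in 𝓝[>] (0 : ℝ), ‖K p‖ ≤ 1)
    (h0 : K 0 = 1) (hd : HasDerivAt K L 0) (t : ℝ≥0) :
    Tendsto (fun p => K p ^ ⌊(t : ℝ) / p⌋₊) (𝓝[>] 0) (𝓝 (NormedSpace.exp ((t : ℝ) • L))) := by
  -- `C` bounds all powers `exp (p • L) ^ k = exp ((k * p) • L)` with `k ≤ ⌊t / p⌋₊`, since then `k
  -- * p` stays in `[0, t]`.
  obtain ⟨C, hC⟩ := (isCompact_Icc (a := (0 : ℝ)) (b := t)).exists_bound_of_continuousOn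
    (continuous_exp_smul L).continuousOn
  have hE : HasDerivAt (fun p : ℝ => NormedSpace.exp (p • L)) L 0 := by
    simpa using hasDerivAt_exp_smul_const L (0 : ℝ)
  -- Both families have value `1` and derivative `L` at `0`, so they differ by `o(p)`; about `t / p`
  -- factors accumulate a total error `o(1)`.
  have hdiff : Tendsto (fun p : ℝ => p⁻¹ • (K p - NormedSpace.exp (p • L))) (𝓝[>] 0) (𝓝 0) := by
    have := (hd.sub hE).tendsto_slope_zero_right
    simpa [h0] using this
  have hlim : Tendsto (fun p => K p ^ ⌊(t : ℝ) / p⌋₊ - NormedSpace.exp (p • L) ^ ⌊(t : ℝ) / p⌋₊)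
      (𝓝[>] 0) (𝓝 0) := by
    have hz := (((tendsto_floor_div_mul t).mul hdiff.norm).mul_const C)
    rw [norm_zero, mul_zero, zero_mul] at hz
    refine squeeze_zero_norm' ?_ hz
    filter_upwards [hK, self_mem_nhdsWithin] with p hp hp0
    have hp0 : 0 < p := hp0
    refine (norm_pow_sub_pow_le (C := C) hp _ fun k hk => ?_).trans (le_of_eq ?_)
    · rw [exp_smul_pow]
      refine hC _ ⟨by positivity, ?_⟩
      rw [← le_div_iff₀ hp0]
      exact (Nat.cast_le.2 hk).trans (Nat.floor_le (by positivity))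
    · rw [norm_smul, Real.norm_eq_abs, abs_of_pos (inv_pos.2 hp0)]
      field_simp
  have h2 := ((continuous_exp_smul L).tendsto (t : ℝ)).comp (tendsto_floor_div_mul t)
  have := hlim.add h2
  simpa [exp_smul_pow, Function.comp_def] using this

end ExpLimit

/-! ### Markov chains given by random mappings driven by independent bits -/

section RandomMapping

variable {B S S' : Type*} [Fintype B]

/-- The law of a bit: `true` with probability `p`. -/
def bitWeight (p : ℝ) (b : Bool) : ℝ := if b then p else 1 - p

lemma bitWeight_nonneg {p : ℝ} (h0 : 0 ≤ p) (h1 : p ≤ 1) (b : Bool) : 0 ≤ bitWeight p b := by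
  unfold bitWeight; split_ifs <;> linarith

/-- The law of a finite family of independent bits. -/
def bitsWeight (p : ℝ) (e : B → Bool) : ℝ := ∏ b, bitWeight p (e b)

lemma bitsWeight_nonneg {p : ℝ} (h0 : 0 ≤ p) (h1 : p ≤ 1) (e : B → Bool) : 0 ≤ bitsWeight p e :=
  Finset.prod_nonneg fun _ _ => bitWeight_nonneg h0 h1 _

variable [DecidableEq B]

/-- The probability that each bit satisfies its own constraint. -/
lemma sum_bitsWeight_forall (p : ℝ) (C : B → Bool → Prop) [∀ b c, Decidable (C b c)]
    [∀ e : B → Bool, Decidable (∀ b, C b (e b))] :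
    (∑ e : B → Bool, if ∀ b, C b (e b) then bitsWeight p e else 0) =
      ∏ b, ∑ c, if C b c then bitWeight p c else 0 := by
  rw [Finset.prod_univ_sum, Fintype.piFinset_univ]
  refine Finset.sum_congr rfl fun e _ => ?_
  split_ifs with h
  · exact Finset.prod_congr rfl fun b _ => (if_pos (h b)).symm
  · obtain ⟨b, hb⟩ := not_forall.1 h
    exact (Finset.prod_eq_zero (Finset.mem_univ b) (if_neg hb)).symm

lemma sum_bitsWeight (p : ℝ) : ∑ e : B → Bool, bitsWeight p e = 1 := by
  have h := sum_bitsWeight_forall (B := B) p fun _ _ => True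
  simpa [bitWeight] using h

open Classical in
/-- The transition matrix of `x ↦ U e x`, where `e` is a random family of bits. -/
def mapKernel (U : (B → Bool) → S → S) (p : ℝ) (x y : S) : ℝ :=
  ∑ e, if U e x = y then bitsWeight p e else 0

/-- The operator on `ℓ¹(S)` of `x ↦ U e x`, where `e` is a random family of bits. -/
def mapOp (U : (B → Bool) → S → S) (p : ℝ) : L1 S →L[ℝ] L1 S :=
  ∑ e, bitsWeight p e • L1.map (U e)

lemma mat_mapOp (U : (B → Bool) → S → S) (p : ℝ) : mat (mapOp U p) = mapKernel U p := by
  funext x y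
  change L1.eval y (mapOp U p (dirac x)) = _
  simp [mapOp, mapKernel, L1.map_dirac, L1.eval_apply, dirac_apply, sum_apply]

lemma isStochasticOp_mapOp (U : (B → Bool) → S → S) {p : ℝ} (h0 : 0 ≤ p) (h1 : p ≤ 1) :
    IsStochasticOp (mapOp U p) where
  nonneg x y := by
    rw [mat_mapOp]
    refine Finset.sum_nonneg fun e _ => ?_
    split_ifs
    exacts [bitsWeight_nonneg h0 h1 e, le_rfl]
  mass := L1.clm_ext fun x => by
    simp [mapOp, L1.map_dirac, L1.mass_dirac, sum_apply, sum_bitsWeight]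

lemma norm_mapOp_le (U : (B → Bool) → S → S) {p : ℝ} (h0 : 0 ≤ p) (h1 : p ≤ 1) :
    ‖mapOp U p‖ ≤ 1 := by
  rw [← sum_bitsWeight (B := B) p]
  refine norm_sum_le_of_le _ fun e _ => ?_
  rw [norm_smul, Real.norm_of_nonneg (bitsWeight_nonneg h0 h1 e)]
  exact mul_le_of_le_one_right (bitsWeight_nonneg h0 h1 e) (L1.norm_map_le _)

lemma mapOp_zero {U : (B → Bool) → S → S} (hU : U (fun _ => false) = id) : mapOp U 0 = 1 := by
  have hw : ∀ e : B → Bool, bitsWeight 0 e = if e = fun _ => false then 1 else 0 := fun e => by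
    have : ∀ b, bitWeight 0 b = if b = false then 1 else 0 := by simp [bitWeight]
    simp only [bitsWeight, this, Fintype.prod_boole, funext_iff]
  refine L1.clm_ext fun x => ?_
  simp [mapOp, hw, hU, L1.map_dirac, ite_smul]

/-- A single bit equal to `true`. -/
def singleBit (b : B) : B → Bool := Function.update (fun _ => false) b true

/-- The generator of the chain where each bit becomes `true` at rate one. -/
def mapGen (U : (B → Bool) → S → S) : L1 S →L[ℝ] L1 S :=
  ∑ b, (L1.map (U (singleBit b)) - L1.map (U fun _ => false))

lemma hasDerivAt_bitWeight (c : Bool) :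
    HasDerivAt (fun p => bitWeight p c) (if c then 1 else -1) 0 := by
  cases c
  · simpa [bitWeight] using (hasDerivAt_id (0 : ℝ)).const_sub 1
  · simpa [bitWeight] using hasDerivAt_id' (0 : ℝ)

lemma hasDerivAt_mapOp (U : (B → Bool) → S → S) : HasDerivAt (mapOp U) (mapGen U) 0 := by
  have hw : ∀ e : B → Bool, HasDerivAt (fun p => bitsWeight p e • L1.map (U e))
      (∑ b, ((∏ j ∈ Finset.univ.erase b, bitWeight 0 (e j)) • (if e b then (1 : ℝ) else -1)) •
        L1.map (U e)) 0 := fun e => by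
    rw [← Finset.sum_smul]
    have := HasDerivAt.fun_finsetProd (u := Finset.univ) fun b _ => hasDerivAt_bitWeight (e b)
    exact this.smul_const (L1.map (U e))
  have h := HasDerivAt.fun_sum (u := Finset.univ) fun e _ => hw e
  refine HasDerivAt.congr_deriv h ?_
  rw [Finset.sum_comm, mapGen]
  refine Finset.sum_congr rfl fun b _ => ?_
  have hne : singleBit b ≠ fun _ => false := fun h => by
    simpa [singleBit] using congrFun h b
  -- At `p = 0` the product over the bits other than `b` vanishes unless they are all `false`. Two
  -- families survive, with derivatives `1` and `-1` according to the value of bit `b`.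
  rw [← Finset.sum_subset (Finset.subset_univ {singleBit b, fun _ => false}), Finset.sum_pair hne]
  · have h1 : ∏ j ∈ Finset.univ.erase b, bitWeight 0 (singleBit b j) = 1 :=
      Finset.prod_eq_one fun j hj => by
        simp [singleBit, bitWeight, Function.update_of_ne (Finset.ne_of_mem_erase hj)]
    have h2 : ∏ j ∈ Finset.univ.erase b, bitWeight 0 false = 1 :=
      Finset.prod_eq_one fun j hj => by simp [bitWeight]
    rw [h1, h2]
    simp [singleBit, sub_eq_add_neg]
  · intro e _ he
    obtain ⟨j, hj, hj'⟩ : ∃ j ≠ b, e j = true := by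
      by_contra! hc
      simp only [Finset.mem_insert, Finset.mem_singleton, not_or] at he
      cases hb : e b
      · refine he.2 (funext fun j => ?_)
        by_cases hj : j = b
        · exact hj ▸ hb
        · simpa using hc j hj
      · refine he.1 (funext fun j => ?_)
        by_cases hj : j = b
        · subst hj; simp [singleBit, hb]
        · simpa [singleBit, Function.update_of_ne hj] using hc j hj
    rw [Finset.prod_eq_zero (Finset.mem_erase.2 ⟨hj, Finset.mem_univ j⟩) (by simp [bitWeight, hj'])]
    simp

lemma map_comp_mapOp {φ : S → S'} {U : (B → Bool) → S → S} {V : (B → Bool) → S' → S'}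
    (h : ∀ e x, φ (U e x) = V e (φ x)) (p : ℝ) :
    L1.map φ ∘L mapOp U p = mapOp V p ∘L L1.map φ :=
  L1.clm_ext fun x => by simp [mapOp, L1.map_dirac, sum_apply, h]

/-- The semigroup of the chain where each bit becomes `true` at rate one. -/
def mapSemigroup (U : (B → Bool) → S → S) (t : ℝ≥0) : L1 S →L[ℝ] L1 S :=
  NormedSpace.exp ((t : ℝ) • mapGen U)

variable {U : (B → Bool) → S → S}

lemma eventually_mem_unitInterval : ∀ᶠ p in 𝓝[>] (0 : ℝ), 0 ≤ p ∧ p ≤ 1 := by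
  filter_upwards [Ioc_mem_nhdsGT (zero_lt_one (α := ℝ))] with p hp using ⟨hp.1.le, hp.2⟩

lemma tendsto_mapOp_pow (hU : U (fun _ => false) = id) (t : ℝ≥0) :
    Tendsto (fun p => mapOp U p ^ ⌊(t : ℝ) / p⌋₊) (𝓝[>] 0) (𝓝 (mapSemigroup U t)) :=
  tendsto_pow_floor_div (eventually_mem_unitInterval.mono fun _ hp => norm_mapOp_le U hp.1 hp.2)
    (mapOp_zero hU) (hasDerivAt_mapOp U) t

lemma tendsto_kernelPow_mapKernel (hU : U (fun _ => false) = id) (t : ℝ≥0) (x y : S) :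
    Tendsto (fun p => kernelPow (mapKernel U p) ⌊(t : ℝ) / p⌋₊ x y) (𝓝[>] 0)
      (𝓝 (mat (mapSemigroup U t) x y)) := by
  simp only [← mat_mapOp, kernelPow_mat]
  exact ((continuous_mat x y).tendsto _).comp (tendsto_mapOp_pow hU t)

lemma isStochasticOp_mapSemigroup (hU : U (fun _ => false) = id) (t : ℝ≥0) :
    IsStochasticOp (mapSemigroup U t) :=
  .of_tendsto (eventually_mem_unitInterval.mono fun _ hp =>
    (isStochasticOp_mapOp U hp.1 hp.2).pow _) (tendsto_mapOp_pow hU t)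

lemma mapSemigroup_add (s t : ℝ≥0) :
    mapSemigroup U (s + t) = mapSemigroup U t * mapSemigroup U s :=
  exp_add_smul (mapGen U) s t

lemma isTransitionFunction_mapSemigroup (hU : U (fun _ => false) = id) :
    IsTransitionFunction fun t => mat (mapSemigroup U t) where
  stochastic t := (isStochasticOp_mapSemigroup hU t).isStochastic
  zero x y := by
    rw [mapSemigroup, NNReal.coe_zero, zero_smul, NormedSpace.exp_zero, mat_one]
  chapman_kolmogorov s t x y := by
    rw [mapSemigroup_add]
    exact hasSum_mat_mul _ _ x y
  standard x := by
    have h := ((continuous_mat x x).comp ((continuous_exp_smul (mapGen U)).comp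
      NNReal.continuous_coe)).tendsto 0
    simp only [Function.comp_apply, NNReal.coe_zero, zero_smul, NormedSpace.exp_zero, mat_one,
      if_true] at h
    exact h.mono_left nhdsWithin_le_nhds

/-- The intertwining holds for all powers at every `p`, and composition with the fixed push-forward
is continuous in operator norm. -/
lemma map_comp_mapSemigroup {φ : S → S'} {V : (B → Bool) → S' → S'}
    (h : ∀ e x, φ (U e x) = V e (φ x)) (hU : U (fun _ => false) = id)
    (hV : V (fun _ => false) = id) (t : ℝ≥0) :
    L1.map φ ∘L mapSemigroup U t = mapSemigroup V t ∘L L1.map φ := by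
  have h1 := ((ContinuousLinearMap.compL ℝ (L1 S) (L1 S) (L1 S') (L1.map φ)).continuous.tendsto
    _).comp (tendsto_mapOp_pow hU t)
  have h2 := (((ContinuousLinearMap.compL ℝ (L1 S) (L1 S') (L1 S')).flip
    (L1.map φ)).continuous.tendsto _).comp (tendsto_mapOp_pow hV t)
  exact tendsto_nhds_unique_of_eventuallyEq h1 h2
    (.of_forall fun p => map_comp_pow (map_comp_mapOp h p) _)

lemma projectsTo_kernelPow_mapKernel {φ : S → S'} {V : (B → Bool) → S' → S'}
    (h : ∀ e x, φ (U e x) = V e (φ x)) (p : ℝ) (n : ℕ) :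
    ProjectsTo φ (kernelPow (mapKernel U p) n) (kernelPow (mapKernel V p) n) := by
  simp only [← mat_mapOp, kernelPow_mat]
  exact projectsTo_mat (map_comp_pow (map_comp_mapOp h p) n)

lemma projectsTo_mapKernel {φ : S → S'} {V : (B → Bool) → S' → S'}
    (h : ∀ e x, φ (U e x) = V e (φ x)) (p : ℝ) :
    ProjectsTo φ (mapKernel U p) (mapKernel V p) := by
  simp only [← mat_mapOp]
  exact projectsTo_mat (map_comp_mapOp h p)

lemma isStochastic_mapKernel {p : ℝ} (h0 : 0 ≤ p) (h1 : p ≤ 1) : IsStochastic (mapKernel U p) :=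
  mat_mapOp U p ▸ (isStochasticOp_mapOp U h0 h1).isStochastic

/-- The exponential series of the generator, entrywise. -/
lemma mat_mapSemigroup (t : ℝ≥0) (x y : S) :
    mat (mapSemigroup U t) x y =
      ∑' k : ℕ, (t : ℝ) ^ k / (k.factorial : ℝ) * mat (mapGen U ^ k) x y := by
  have h := NormedSpace.exp_series_hasSum_exp' (𝕂 := ℝ) ((t : ℝ) • mapGen U)
  have h' := (h.mapL (ContinuousLinearMap.apply ℝ (L1 S) (dirac x))).mapL (L1.eval y)
  refine h'.tsum_eq.symm.trans (tsum_congr fun k => ?_)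
  simp [smul_pow, mat, L1.eval_apply, div_eq_inv_mul, mul_assoc]

end RandomMapping

/-! ### Projections of Markov chains -/

section Projection

lemma hasSum_measureReal_inter {Ω C : Type*} [MeasurableSpace Ω] (μ : Measure Ω)
    [IsFiniteMeasure μ] [Countable C] {Z : Ω → C} (hZ : ∀ c, MeasurableSet {ω | Z ω = c})
    (A : Set Ω) : HasSum (fun c => μ.real (A ∩ {ω | Z ω = c})) (μ.real A) := by
  have hU : (⋃ c, {ω | Z ω = c}) = Set.univ := by ext; simp
  have h : μ A = ∑' c, μ (A ∩ {ω | Z ω = c}) := by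
    -- Restricting the measure to `A` leaves only the fibres of `Z` to be measurable; `A` itself may
    -- be any set.
    rw [← Measure.restrict_apply_univ, ← hU, measure_iUnion _ hZ]
    · exact tsum_congr fun c => by rw [Measure.restrict_apply (hZ c), Set.inter_comm]
    · exact fun c d hcd => Set.disjoint_left.2 fun ω (hc : _ = _) (hd : _ = _) =>
        hcd (hc.symm.trans hd)
  have hfin : ∑' c, μ (A ∩ {ω | Z ω = c}) ≠ ⊤ := h ▸ measure_ne_top μ A
  have hs := ENNReal.hasSum_toReal hfin
  rw [← ENNReal.tsum_toReal_eq fun c => measure_ne_top μ _, ← h] at hs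
  exact hs

variable {S S' T Ω : Type*} [LinearOrder T] [Sub T] [MeasurableSpace Ω] {μ : Measure Ω}
  {P : T → S → S → ℝ} {X : T → Ω → S}

/-- The Markov property, for the last one of finitely many times. -/
lemma IsMarkovChain.joint_law_succ (hX : IsMarkovChain μ P X) {m : ℕ} {t : Fin (m + 2) → T}
    (ht : StrictMono t) (z : Fin (m + 1) → S) (b : S) :
    μ.real {ω | (∀ i : Fin (m + 1), X (t i.castSucc) ω = z i) ∧ X (t (Fin.last _)) ω = b} =
      μ.real {ω | ∀ i : Fin (m + 1), X (t i.castSucc) ω = z i} *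
        P (t (Fin.last _) - t (Fin.last m).castSucc) (z (Fin.last m)) b := by
  have h1 := hX.joint_law (m + 1) t (Fin.snoc z b) ht
  have h2 := hX.joint_law m (fun i => t i.castSucc) z fun i j hij => ht (by simpa using hij)
  have h0 : (0 : Fin (m + 2)) = (0 : Fin (m + 1)).castSucc := rfl
  rw [h2, mul_assoc]
  rw [Fin.prod_univ_castSucc] at h1
  simp only [Fin.forall_fin_succ', h0, Fin.succ_castSucc, Fin.succ_last, Fin.snoc_castSucc,
    Fin.snoc_last] at h1 ⊢
  exact h1

/-- If the transition matrices project under `φ`, then so does the Markov chain. -/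
theorem IsMarkovChain.project [Countable S] [IsFiniteMeasure μ] {P' : T → S' → S' → ℝ}
    {φ : S → S'} (hP : ∀ t, ProjectsTo φ (P t) (P' t)) (hX : IsMarkovChain μ P X) :
    IsMarkovChain μ P' fun t ω => φ (X t ω) where
  measurableSet_eq t s := by
    have : {ω | φ (X t ω) = s} = ⋃ z : {z // φ z = s}, {ω | X t ω = z} := by
      ext ω; simp
    rw [this]
    exact .iUnion fun z => hX.measurableSet_eq t z
  joint_law m := by
    induction m with
    | zero => intro t s _; simp
    | succ m ih =>
      intro t s ht
      have hmZ : ∀ z : Fin (m + 1) → S,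
          MeasurableSet {ω | (fun i : Fin (m + 1) => X (t i.castSucc) ω) = z} := fun z => by
        simp only [funext_iff, Set.ofPred_forall]
        exact .iInter fun i => hX.measurableSet_eq _ _
      -- Conditioning is on the full past `z` of the original chain, not only on its image. If `z`
      -- lies over `s`, summing the last step over the fibre gives a factor that depends on `z` only
      -- through `φ`; otherwise both sides vanish. Summing over the countably many `z` then removes
      -- the conditioning.
      have key : ∀ z : Fin (m + 1) → S,
          μ.real ({ω | ∀ i, φ (X (t i) ω) = s i} ∩
            {ω | (fun i : Fin (m + 1) => X (t i.castSucc) ω) = z}) =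
          μ.real ({ω | ∀ i : Fin (m + 1), φ (X (t i.castSucc) ω) = s i.castSucc} ∩
            {ω | (fun i : Fin (m + 1) => X (t i.castSucc) ω) = z}) *
            P' (t (Fin.last _) - t (Fin.last m).castSucc) (s (Fin.last m).castSucc)
              (s (Fin.last _)) := fun z => by
        by_cases hz : ∀ i, φ (z i) = s i.castSucc
        · have h1 := hasSum_measureReal_inter μ (hX.measurableSet_eq (t (Fin.last _)))
            ({ω | ∀ i, φ (X (t i) ω) = s i} ∩
              {ω | (fun i : Fin (m + 1) => X (t i.castSucc) ω) = z})
          have h2 := (hP (t (Fin.last _) - t (Fin.last m).castSucc) (z (Fin.last m))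
            (s (Fin.last _))).mul_left
              (μ.real {ω | ∀ i : Fin (m + 1), X (t i.castSucc) ω = z i})
          have hA : {ω | ∀ i : Fin (m + 1), φ (X (t i.castSucc) ω) = s i.castSucc} ∩
              {ω | (fun i : Fin (m + 1) => X (t i.castSucc) ω) = z} =
              {ω | ∀ i : Fin (m + 1), X (t i.castSucc) ω = z i} := by
            ext ω
            simp only [funext_iff, Set.mem_inter_iff, Set.mem_ofPred_eq, and_iff_right_iff_imp]
            exact fun h i => by rw [h, hz]
          rw [hA, ← hz]
          refine HasSum.unique h1 ?_
          change HasSum ((fun b => μ.real {ω | ∀ i : Fin (m + 1), X (t i.castSucc) ω = z i} *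
            P (t (Fin.last _) - t (Fin.last m).castSucc) (z (Fin.last m)) b) ∘
              ((↑) : {b | φ b = s (Fin.last _)} → S)) _ at h2
          rw [hasSum_subtype_iff_indicator] at h2
          convert h2 using 2 with b
          classical
          rw [Set.indicator_apply]
          split_ifs with hb
          · rw [← hX.joint_law_succ ht]
            congr 1
            ext ω
            simp only [funext_iff, Set.mem_inter_iff, Set.mem_ofPred_eq,
              Fin.forall_fin_succ' (n := m + 1)]
            constructor
            · exact fun h => ⟨h.1.2, h.2⟩
            · refine fun h => ⟨⟨⟨fun i => ?_, ?_⟩, h.1⟩, h.2⟩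
              · rw [h.1, hz]
              · rw [h.2]; exact hb
          · convert measureReal_empty
            ext ω
            simp only [Set.mem_inter_iff, Set.mem_ofPred_eq, Set.mem_empty_iff_false, iff_false]
            rintro ⟨⟨h, -⟩, h'⟩
            exact hb (h' ▸ h (Fin.last _))
        · have hF : {ω | ∀ i : Fin (m + 1), φ (X (t i.castSucc) ω) = s i.castSucc} ∩
              {ω | (fun i : Fin (m + 1) => X (t i.castSucc) ω) = z} = ∅ := by
            ext ω
            simp only [funext_iff, Set.mem_inter_iff, Set.mem_ofPred_eq, Set.mem_empty_iff_false,
              iff_false]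
            rintro ⟨h, h'⟩
            exact hz fun i => by rw [← h', h]
          have hF' : {ω | ∀ i, φ (X (t i) ω) = s i} ∩
              {ω | (fun i : Fin (m + 1) => X (t i.castSucc) ω) = z} = ∅ :=
            Set.eq_empty_of_forall_notMem fun ω h => hF.subset ⟨fun i => h.1 i.castSucc, h.2⟩
          rw [hF, hF', measureReal_empty, zero_mul]
      have h1 := hasSum_measureReal_inter μ hmZ {ω | ∀ i, φ (X (t i) ω) = s i}
      have h2 := (hasSum_measureReal_inter μ hmZ
        {ω | ∀ i : Fin (m + 1), φ (X (t i.castSucc) ω) = s i.castSucc}).mul_right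
          (P' (t (Fin.last _) - t (Fin.last m).castSucc) (s (Fin.last m).castSucc)
            (s (Fin.last _)))
      simp only [key] at h1
      rw [h1.unique h2, ih (fun i => t i.castSucc) (fun i => s i.castSucc)
        fun i j hij => ht (by simpa using hij), Fin.prod_univ_castSucc, mul_assoc]
      rfl

lemma IsCadlagPath.comp {x : ℝ≥0 → S} (h : IsCadlagPath x) (φ : S → S') :
    IsCadlagPath fun t => φ (x t) :=
  ⟨fun t => (h.1 t).mono fun _ hs => congrArg φ hs, fun t ht =>
    let ⟨a, ha⟩ := h.2 t ht
    ⟨φ a, ha.mono fun _ hs => congrArg φ hs⟩⟩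

end Projection

/-! ### One level of the intertwined dynamics -/

section Level

lemma vandermonde_pos {n : ℕ} {x : Fin n → ℤ} (hx : StrictMono x) : 0 < vandermonde x :=
  Finset.prod_pos fun i _ => Finset.prod_pos fun j hj => by
    have := hx (Finset.mem_Ioi.1 hj)
    rw [sub_pos]; exact_mod_cast this

lemma oneStep_ne_zero_iff {p : ℝ} {a z : ℤ} :
    oneStep p a z ≠ 0 ↔ z = a + 1 ∧ p ≠ 0 ∨ z = a ∧ 1 - p ≠ 0 := by
  unfold oneStep
  split_ifs with h1 h2
  · subst h1; simp
  · subst h2; simp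
  · simp [h1, h2]

/-- The displacement coded by a bit. -/
def bitStep (c : Bool) : ℤ := if c then 1 else 0

lemma oneStep_eq_sum (p : ℝ) (a z : ℤ) :
    oneStep p a z = ∑ c, if a + bitStep c = z then bitWeight p c else 0 := by
  rw [Fintype.sum_bool]
  simp only [oneStep, bitStep, bitWeight, if_true, add_zero, Bool.false_eq_true, if_false]
  split_ifs <;> first | omega | simp

/-- No two particles of a strictly ordered configuration can exchange their positions by jumps of
size at most one, so that only the identity contributes to the determinant. -/
lemma levelStep_eq (p : ℝ) {n : ℕ} {x y : Fin n → ℤ} (hx : StrictMono x) (hy : StrictMono y) :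
    levelStep p x y = vandermonde y / vandermonde x * ∏ i, oneStep p (x i) (y i) := by
  rw [levelStep, Matrix.det_apply, Finset.sum_eq_single 1]
  · simp
  · intro σ _ hσ
    suffices ∏ i, oneStep p (x (σ i)) (y i) = 0 by simp [this]
    by_contra h
    rw [Finset.prod_eq_zero_iff] at h
    push Not at h
    have hb : ∀ i, y i = x (σ i) + 1 ∨ y i = x (σ i) := fun i =>
      (oneStep_ne_zero_iff.1 (h i (Finset.mem_univ i))).imp And.left And.left
    -- An inversion `σ j < σ i` with `i < j` would give `x (σ j) + 1 ≤ x (σ i) ≤ y i < y j ≤ x (σ j)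
    -- + 1`. A strictly increasing permutation of `Fin n` is the identity.
    have hmono : StrictMono σ := fun i j hij => by
      by_contra! hji
      have h1 := hx (lt_of_le_of_ne hji fun h => hij.ne' (σ.injective h))
      have h2 := hy hij
      have h3 := hb i
      have h4 := hb j
      omega
    exact hσ (Equiv.ext fun i => congrFun hmono.eq_id i)
  · simp

/-- The position `a` of particle `i` is compatible with the row `y` below: `y_{i-1} ≤ a < y_i`. -/
def Fits {n : ℕ} (y : Fin n → ℤ) (i : Fin (n + 1)) (a : ℤ) : Prop :=
  (∀ j : Fin n, j.castSucc = i → a < y j) ∧ ∀ j : Fin n, j.succ = i → y j ≤ a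

/-- With the lower row fixed, interlacing decouples into separate constraints on the upper
particles; this is the source of all product formulas below. -/
lemma interlaces_iff_fits {n : ℕ} {y : Fin n → ℤ} {x : Fin (n + 1) → ℤ} :
    Interlaces y x ↔ ∀ i, Fits y i (x i) := by
  constructor
  · exact fun h i => ⟨fun j hj => hj ▸ (h j).1, fun j hj => hj ▸ (h j).2⟩
  · exact fun h j => ⟨(h _).1 j rfl, (h _).2 j rfl⟩

lemma Interlaces.strictMono {n : ℕ} {y : Fin n → ℤ} {x : Fin (n + 1) → ℤ} (h : Interlaces y x) :
    StrictMono x :=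
  Fin.strictMono_iff_lt_succ.2 fun i => (h i).1.trans_le (h i).2

open Classical in
/-- The probability that a free step from `a` is compatible with the row `y` below. -/
def fitProb (p : ℝ) {n : ℕ} (y : Fin n → ℤ) (i : Fin (n + 1)) (a : ℤ) : ℝ :=
  ∑ c, if Fits y i (a + bitStep c) then bitWeight p c else 0

lemma fitProb_pos {p : ℝ} (h0 : 0 ≤ p) (h1 : p ≤ 1) {n : ℕ} {y : Fin n → ℤ} {i : Fin (n + 1)}
    {a z : ℤ} (hz : Fits y i z) (ho : oneStep p a z ≠ 0) : 0 < fitProb p y i a := by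
  obtain ⟨c, rfl, hc⟩ : ∃ c, z = a + bitStep c ∧ bitWeight p c ≠ 0 := by
    rcases oneStep_ne_zero_iff.1 ho with h | h
    · exact ⟨true, by simpa [bitStep, bitWeight] using h⟩
    · exact ⟨false, by simpa [bitStep, bitWeight] using h⟩
  refine Finset.sum_pos' (fun c _ => ?_) ⟨c, Finset.mem_univ c, ?_⟩
  · split_ifs
    exacts [bitWeight_nonneg h0 h1 c, le_rfl]
  · rw [if_pos hz]
    exact (bitWeight_nonneg h0 h1 c).lt_of_ne' hc

-- The factor `vandermonde z` of the h-transform cancels against the denominator of the link, so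
-- apart from a constant in `z` only independent free steps and the interlacing indicator remain.
open Classical in
lemma levelStep_mul_link (p : ℝ) {n : ℕ} {x z : Fin (n + 1) → ℤ} (y : Fin n → ℤ)
    (hx : StrictMono x) (hz : StrictMono z) :
    levelStep p x z * link z y = n.factorial * (vandermonde y / vandermonde x) *
      if Interlaces y z then ∏ i, oneStep p (x i) (z i) else 0 := by
  have h1 := (vandermonde_pos hz).ne'
  rw [levelStep_eq p hx hz, link]
  split_ifs
  · field_simp
  · simp

/-- The product of the level dynamics with the link factorizes over the particles. -/
lemma stepLink_eq (p : ℝ) {n : ℕ} {x : Fin (n + 1) → ℤ} (y : Fin n → ℤ) (hx : StrictMono x) :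
    stepLink p x y =
      n.factorial * (vandermonde y / vandermonde x) * ∏ i, fitProb p y i (x i) := by
  classical
  have hterm : ∀ z : {z : Fin (n + 1) → ℤ // StrictMono z},
      levelStep p x z * link z.1 y = n.factorial * (vandermonde y / vandermonde x) *
        ∑ e : Fin (n + 1) → Bool, if (∀ i, x i + bitStep (e i) = z.1 i) ∧ Interlaces y z.1 then
          bitsWeight p e else 0 := fun z => by
    rw [levelStep_mul_link p y hx z.2]
    congr 1
    split_ifs with h
    · simp only [oneStep_eq_sum, h, and_true]
      exact (sum_bitsWeight_forall p fun i c => x i + bitStep c = z.1 i).symm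
    · simp [h]
  -- The bits determine `z`, and interlacing already forces `z` to be strictly increasing, so the
  -- restriction to ordered configurations costs nothing.
  have hsum : ∀ e : Fin (n + 1) → Bool,
      HasSum (fun z : {z : Fin (n + 1) → ℤ // StrictMono z} =>
        if (∀ i, x i + bitStep (e i) = z.1 i) ∧ Interlaces y z.1 then bitsWeight p e else 0)
        (if ∀ i, Fits y i (x i + bitStep (e i)) then bitsWeight p e else 0) := fun e => by
    split_ifs with h
    · have h' : Interlaces y fun i => x i + bitStep (e i) := interlaces_iff_fits.2 h
      convert hasSum_ite_eq (⟨_, h'.strictMono⟩ : {z : Fin (n + 1) → ℤ // StrictMono z})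
        (bitsWeight p e) using 2 with z
      refine if_congr ⟨fun hz => Subtype.ext (funext fun i => (hz.1 i).symm), ?_⟩ rfl rfl
      rintro rfl
      exact ⟨fun _ => rfl, h'⟩
    · convert hasSum_zero using 2 with z
      refine if_neg fun hz => h ?_
      have := interlaces_iff_fits.1 hz.2
      exact fun i => hz.1 i ▸ this i
  rw [stepLink]
  simp only [hterm, fitProb]
  rw [((hasSum_sum fun e _ => hsum e).mul_left _).tsum_eq]
  exact congrArg _ (sum_bitsWeight_forall p fun i c => Fits y i (x i + bitStep c))

open Classical in
/-- The new position of particle `i` at `a`, given the new row `y` below and a bit: the particle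
is blocked or pushed by the row below if need be, and makes a free step otherwise. -/
def nextPos {n : ℕ} (y : Fin n → ℤ) (i : Fin (n + 1)) (a : ℤ) (c : Bool) : ℤ :=
  if Fits y i (a + 1) then if Fits y i a then a + bitStep c else a + 1 else a

/-- The law of the new position of a particle. -/
def nextPosProb (p : ℝ) {n : ℕ} (y : Fin n → ℤ) (i : Fin (n + 1)) (a z : ℤ) : ℝ :=
  ∑ c, if nextPos y i a c = z then bitWeight p c else 0

lemma nextPos_eq_or {n : ℕ} (y : Fin n → ℤ) (i : Fin (n + 1)) (a : ℤ) (c : Bool) :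
    nextPos y i a c = a ∨ nextPos y i a c = a + 1 := by
  cases c <;> simp only [nextPos, bitStep] <;> split_ifs <;> simp

/-- If both `a` and `a + 1` fit, the denominator is `p + (1 - p) = 1` and the step is free. If only
one fits, numerator and denominator agree and the move is forced. The hypothesis `ho` excludes `0 /
0` at `p = 0` and `p = 1`. -/
lemma oneStep_div_fitProb (p : ℝ) {n : ℕ} {y : Fin n → ℤ} {i : Fin (n + 1)}
    {a z : ℤ} (hz : Fits y i z) (ho : oneStep p a z ≠ 0) :
    oneStep p a z / fitProb p y i a = nextPosProb p y i a z := by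
  rcases oneStep_ne_zero_iff.1 ho with ⟨rfl, hp⟩ | ⟨rfl, hp⟩
  · by_cases h : Fits y i a <;>
      simp [oneStep, fitProb, nextPosProb, nextPos, bitStep, bitWeight, hz, h, hp]
  · by_cases h : Fits y i (z + 1) <;>
      simp [oneStep, fitProb, nextPosProb, nextPos, bitStep, bitWeight, hz, h, hp]

section lower

variable {n : ℕ} {x' y' : Fin n → ℤ} {i : Fin (n + 1)} {a : ℤ}

/-- Pushing: the lower row moves only to the right, so staying at `a` can fail only because the
lower-left neighbour has just jumped from `a` to `a + 1`. -/
lemma exists_of_not_fits (ha : Fits x' i a) (hxy : ∀ j, y' j = x' j + 1 ∨ y' j = x' j)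
    (h : ¬ Fits y' i a) : ∃ j : Fin n, j.succ = i ∧ y' j = a + 1 ∧ y' j = x' j + 1 := by
  by_contra! hc
  refine h ⟨fun j hj => ?_, fun j hj => ?_⟩
  · have := ha.1 j hj
    have := hxy j
    omega
  · have := ha.2 j hj
    have := hxy j
    have := hc j hj
    omega

/-- Blocking: a jump to `a + 1` can fail only because the lower-right neighbour was at `a + 1` and
stayed there. -/
lemma exists_of_not_fits_succ (ha : Fits x' i a) (hxy : ∀ j, y' j = x' j + 1 ∨ y' j = x' j)
    (h : ¬ Fits y' i (a + 1)) : ∃ j : Fin n, j.castSucc = i ∧ y' j = a + 1 ∧ y' j = x' j := by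
  by_contra! hc
  refine h ⟨fun j hj => ?_, fun j hj => ?_⟩
  · have := ha.1 j hj
    have := hxy j
    have := hc j hj
    omega
  · have := ha.2 j hj
    have := hxy j
    omega

lemma fits_nextPos (ha : Fits x' i a) (hxy : ∀ j, y' j = x' j + 1 ∨ y' j = x' j)
    (hy : StrictMono y') (c : Bool) : Fits y' i (nextPos y' i a c) := by
  unfold nextPos
  split_ifs with h1 h2
  · cases c <;> simpa [bitStep]
  · exact h1
  -- Being pushed and blocked at once would put two different particles of the strictly increasing
  -- row `y'` at `a + 1`.
  · by_contra h2
    obtain ⟨j, hj, hja, -⟩ := exists_of_not_fits ha hxy h2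
    obtain ⟨k, hk, hka, -⟩ := exists_of_not_fits_succ ha hxy h1
    have hjk : j < k := by
      rw [← Fin.castSucc_lt_castSucc_iff, hk, ← hj]; exact Fin.castSucc_lt_succ
    have := hy hjk
    omega

/-- A forced move copies the move of the neighbour that causes it: a push comes from a jump, so `p ≠
0`, and a block from a stay, so `1 - p ≠ 0`. This matters only at the endpoints of `[0,1]`. -/
lemma oneStep_ne_zero_of_nextPosProb {p : ℝ} {z : ℤ} (ha : Fits x' i a)
    (hxy : ∀ j, oneStep p (x' j) (y' j) ≠ 0) (h : nextPosProb p y' i a z ≠ 0) :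
    oneStep p a z ≠ 0 := by
  have hxy' : ∀ j, y' j = x' j + 1 ∨ y' j = x' j := fun j =>
    (oneStep_ne_zero_iff.1 (hxy j)).imp And.left And.left
  obtain ⟨c, -, hc⟩ := Finset.exists_ne_zero_of_sum_ne_zero h
  obtain ⟨hcz, hw⟩ := ite_ne_right_iff.1 hc
  subst hcz
  rw [oneStep_ne_zero_iff]
  unfold nextPos
  split_ifs with h1 h2
  · cases c <;> simpa [bitStep, bitWeight] using hw
  · obtain ⟨j, -, -, hj⟩ := exists_of_not_fits ha hxy' h2
    rcases oneStep_ne_zero_iff.1 (hxy j) with h | h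
    · exact .inl ⟨rfl, h.2⟩
    · omega
  · obtain ⟨j, -, -, hj⟩ := exists_of_not_fits_succ ha hxy' h1
    rcases oneStep_ne_zero_iff.1 (hxy j) with h | h
    · omega
    · exact .inr ⟨rfl, h.2⟩

end lower

end Level

/-! ### The intertwined chain as a random mapping -/

section Pattern

variable {N : ℕ}

instance : Countable (GT N) := by unfold GT; infer_instance

/-- The index set of the particles of a pattern with `N` levels. -/
abbrev GTIndex (N : ℕ) : Type := Σ n : Fin N, Fin (n.1 + 1)

/-- The row below a given one; the row below the first one is empty. -/
def rowBelow (Y : GT N) : (n : Fin N) → Fin n.1 → ℤ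
  | ⟨0, _⟩ => Fin.elim0
  | ⟨n + 1, h⟩ => Y.1 ⟨n, Nat.lt_of_succ_lt h⟩

lemma interlaces_rowBelow (Y : GT N) : ∀ n : Fin N, Interlaces (rowBelow Y n) (Y.1 n)
  | ⟨0, _⟩ => fun i => i.elim0
  | ⟨n + 1, h⟩ => Y.2 n h

lemma GT.strictMono (Y : GT N) (n : Fin N) : StrictMono (Y.1 n) :=
  (interlaces_rowBelow Y n).strictMono

lemma fits_rowBelow (Y : GT N) (n : Fin N) (i : Fin (n.1 + 1)) : Fits (rowBelow Y n) i (Y.1 n i) :=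
  interlaces_iff_fits.1 (interlaces_rowBelow Y n) i

lemma fits_elim0 (y : Fin 0 → ℤ) (i : Fin 1) (a : ℤ) : Fits y i a :=
  ⟨fun j => j.elim0, fun j => j.elim0⟩

lemma gtNorm_pos {p : ℝ} (h0 : 0 ≤ p) (h1 : p ≤ 1) (X Y : GT N)
    (ho : ∀ n i, oneStep p (X.1 n i) (Y.1 n i) ≠ 0) : ∀ n, 0 < gtNorm p X Y n
  | ⟨0, _⟩ => zero_lt_one
  | ⟨n + 1, h⟩ => by
    rw [gtNorm, stepLink_eq p _ (X.strictMono _)]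
    have hf : ∀ i, 0 < fitProb p (Y.1 ⟨n, Nat.lt_of_succ_lt h⟩) i (X.1 ⟨n + 1, h⟩ i) := fun i =>
      fitProb_pos h0 h1 (fits_rowBelow Y ⟨n + 1, h⟩ i) (ho ⟨n + 1, h⟩ i)
    have := vandermonde_pos (X.strictMono ⟨n + 1, h⟩)
    have := vandermonde_pos (Y.strictMono ⟨n, Nat.lt_of_succ_lt h⟩)
    have := Finset.prod_pos fun i (_ : i ∈ Finset.univ) => hf i
    positivity

/-- The common factor of factorial and Vandermonde quotient cancels between numerator and
normalization; on the first level there is no constraint and `fitProb` is `1`. -/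
lemma gtFactor_eq (p : ℝ) (X Y : GT N) : ∀ n, gtFactor p X Y n =
    ∏ i, oneStep p (X.1 n i) (Y.1 n i) / fitProb p (rowBelow Y n) i (X.1 n i)
  | ⟨0, h⟩ => by
    rw [gtFactor, levelStep_eq p (X.strictMono _) (Y.strictMono _)]
    have hv : ∀ x : Fin 1 → ℤ, vandermonde x = 1 := fun x => by
      simp [vandermonde]
    have hf : ∀ (y : Fin 0 → ℤ) i a, fitProb p y i a = 1 := fun y i a => by
      simp [fitProb, fits_elim0, bitWeight]
    rw [hv, hv, div_one, one_mul]
    exact Finset.prod_congr rfl fun i _ => by rw [hf (rowBelow Y ⟨0, h⟩), div_one]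
  | ⟨n + 1, h⟩ => by
    have hX := vandermonde_pos (X.strictMono ⟨n + 1, h⟩)
    have hY := vandermonde_pos (Y.strictMono ⟨n, Nat.lt_of_succ_lt h⟩)
    rw [gtFactor, stepLink_eq p _ (X.strictMono _),
      levelStep_mul_link p _ (X.strictMono _) (Y.strictMono _), if_pos (Y.2 n h),
      mul_div_mul_left _ _ (by positivity), Finset.prod_div_distrib]
    rfl

lemma oneStep_ne_zero_of_prod (p : ℝ) (X Y : GT N)
    (h : ∀ n i, nextPosProb p (rowBelow Y n) i (X.1 n i) (Y.1 n i) ≠ 0) (n : ℕ) (hn : n < N) :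
    ∀ i, oneStep p (X.1 ⟨n, hn⟩ i) (Y.1 ⟨n, hn⟩ i) ≠ 0 := by
  induction n with
  | zero =>
    exact fun i => oneStep_ne_zero_of_nextPosProb (x' := rowBelow X ⟨0, hn⟩)
      (fits_rowBelow X ⟨0, hn⟩ i) (fun j => j.elim0) (h ⟨0, hn⟩ i)
  | succ n ih =>
    exact fun i => oneStep_ne_zero_of_nextPosProb (fits_rowBelow X ⟨n + 1, hn⟩ i)
      (ih (Nat.lt_of_succ_lt hn)) (h ⟨n + 1, hn⟩ i)

/-- The intertwined chain moves the particles level by level, each one independently of the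
others given the new state of the level below. -/
lemma gtStep_eq_prod {p : ℝ} (h0 : 0 ≤ p) (h1 : p ≤ 1) (X Y : GT N) :
    gtStep N p X Y = ∏ n, ∏ i, nextPosProb p (rowBelow Y n) i (X.1 n i) (Y.1 n i) := by
  by_cases ho : ∀ n i, oneStep p (X.1 n i) (Y.1 n i) ≠ 0
  · rw [gtStep, if_pos (Finset.prod_pos fun n _ => gtNorm_pos h0 h1 X Y ho n)]
    refine Finset.prod_congr rfl fun n _ => ?_
    rw [gtFactor_eq]
    exact Finset.prod_congr rfl fun i _ => oneStep_div_fitProb p (fits_rowBelow Y n i) (ho n i)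
  · have hl : gtStep N p X Y = 0 := by
      push Not at ho
      obtain ⟨n, i, hni⟩ := ho
      rw [gtStep, ite_eq_right_iff]
      intro _
      refine Finset.prod_eq_zero (Finset.mem_univ n) ?_
      rw [gtFactor_eq]
      exact Finset.prod_eq_zero (Finset.mem_univ i) (by rw [hni, zero_div])
    rw [hl]
    -- The product on the right vanishes as well: if all its factors were nonzero, induction over
    -- the levels would make every free step possible, contrary to the case assumption.
    by_contra hr
    refine ho fun n => oneStep_ne_zero_of_prod p X Y (fun n i => ?_) n.1 n.2
    exact Finset.prod_ne_zero_iff.1 (Finset.prod_ne_zero_iff.1 (Ne.symm hr) n (Finset.mem_univ n)) i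
      (Finset.mem_univ i)

/-- The rows of the updated pattern, from the first level up. -/
def rowUpdate (e : GTIndex N → Bool) (X : GT N) : (n : ℕ) → (h : n < N) → Fin (n + 1) → ℤ
  | 0, h => fun i => nextPos (n := 0) Fin.elim0 i (X.1 ⟨0, h⟩ i) (e ⟨⟨0, h⟩, i⟩)
  | n + 1, h => fun i =>
      nextPos (rowUpdate e X n (Nat.lt_of_succ_lt h)) i (X.1 ⟨n + 1, h⟩ i) (e ⟨⟨n + 1, h⟩, i⟩)

lemma rowUpdate_eq_or (e : GTIndex N → Bool) (X : GT N) (n : ℕ) (h : n < N) (i : Fin (n + 1)) :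
    rowUpdate e X n h i = X.1 ⟨n, h⟩ i + 1 ∨ rowUpdate e X n h i = X.1 ⟨n, h⟩ i := by
  cases n <;> exact (nextPos_eq_or _ _ _ _).symm

lemma strictMono_rowUpdate (e : GTIndex N → Bool) (X : GT N) (n : ℕ) (h : n < N) :
    StrictMono (rowUpdate e X n h) := by
  induction n with
  | zero => exact fun i j hij => absurd hij (by omega)
  | succ n ih =>
    exact (interlaces_iff_fits.2 fun i => fits_nextPos (fits_rowBelow X ⟨n + 1, h⟩ i)
      (rowUpdate_eq_or e X n _) (ih _) _).strictMono

/-- The pattern after one step of the intertwined dynamics driven by given bits. -/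
def gtUpdate (e : GTIndex N → Bool) (X : GT N) : GT N :=
  ⟨fun n => rowUpdate e X n.1 n.2, fun n h => interlaces_iff_fits.2 fun i =>
    fits_nextPos (fits_rowBelow X ⟨n + 1, h⟩ i) (rowUpdate_eq_or e X n _)
      (strictMono_rowUpdate e X n _) _⟩

lemma gtUpdate_apply (e : GTIndex N → Bool) (X : GT N) (n : Fin N) (i : Fin (n.1 + 1)) :
    (gtUpdate e X).1 n i = nextPos (rowBelow (gtUpdate e X) n) i (X.1 n i) (e ⟨n, i⟩) := by
  obtain ⟨_ | n, h⟩ := n <;> rfl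

/-- Reaching `Y` allows the recursively updated lower rows to be replaced by those of `Y`. The event
becomes one constraint per bit, and independence of the bits gives a product. -/
lemma gtUpdate_eq_iff (e : GTIndex N → Bool) (X Y : GT N) :
    gtUpdate e X = Y ↔
      ∀ b : GTIndex N, nextPos (rowBelow Y b.1) b.2 (X.1 b.1 b.2) (e b) = Y.1 b.1 b.2 := by
  constructor
  · rintro rfl b
    exact (gtUpdate_apply e X b.1 b.2).symm
  · intro h
    have hrow : ∀ n (hn : n < N), (gtUpdate e X).1 ⟨n, hn⟩ = Y.1 ⟨n, hn⟩ := fun n hn => by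
      induction n with
      | zero => exact funext fun i => h ⟨⟨0, hn⟩, i⟩
      | succ n ih =>
        funext i
        have := h ⟨⟨n + 1, hn⟩, i⟩
        rw [gtUpdate_apply]
        simpa only [rowBelow, ih] using this
    exact Subtype.ext (funext fun n => hrow n.1 n.2)

lemma gtStep_eq_mapKernel {p : ℝ} (h0 : 0 ≤ p) (h1 : p ≤ 1) :
    gtStep N p = mapKernel gtUpdate p := by
  funext X Y
  rw [gtStep_eq_prod h0 h1, mapKernel]
  simp only [gtUpdate_eq_iff]
  rw [sum_bitsWeight_forall p fun (b : GTIndex N) c =>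
    nextPos (rowBelow Y b.1) b.2 (X.1 b.1 b.2) c = Y.1 b.1 b.2, Fintype.prod_sigma]
  rfl

lemma gtUpdate_false : gtUpdate (fun _ : GTIndex N => false) = id := by
  funext X
  refine (gtUpdate_eq_iff _ X X).2 fun b => ?_
  simp [nextPos, fits_rowBelow, bitStep]

end Pattern

/-! ### TASEP as a random mapping -/

section Tasep

variable {N : ℕ}

/-- The new position of particle `n` of sequential TASEP at `a`, given the new configuration `y`
of the particles ahead of it and a bit. -/
def tasepNext (y : Fin N → ℤ) : Fin N → ℤ → Bool → ℤ
  | ⟨0, _⟩, a, c => a + bitStep c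
  | ⟨n + 1, h⟩, a, c => if a + 1 = y ⟨n, Nat.lt_of_succ_lt h⟩ then a else a + bitStep c

/-- The positions of the particles after a step of sequential TASEP driven by given bits. -/
def tasepUpdateFun (e : GTIndex N → Bool) (x : Fin N → ℤ) : (n : ℕ) → n < N → ℤ
  | 0, h => x ⟨0, h⟩ + bitStep (e ⟨⟨0, h⟩, 0⟩)
  | n + 1, h => if x ⟨n + 1, h⟩ + 1 = tasepUpdateFun e x n (Nat.lt_of_succ_lt h) then x ⟨n + 1, h⟩
      else x ⟨n + 1, h⟩ + bitStep (e ⟨⟨n + 1, h⟩, 0⟩)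

lemma bitStep_eq_or (c : Bool) : bitStep c = 0 ∨ bitStep c = 1 := by
  cases c <;> simp [bitStep]

lemma le_tasepUpdateFun (e : GTIndex N → Bool) (x : Fin N → ℤ) (n : ℕ) (h : n < N) :
    x ⟨n, h⟩ ≤ tasepUpdateFun e x n h := by
  cases n with
  | zero =>
    have := bitStep_eq_or (e ⟨⟨0, h⟩, 0⟩)
    rw [tasepUpdateFun]; omega
  | succ n =>
    have := bitStep_eq_or (e ⟨⟨n + 1, h⟩, 0⟩)
    rw [tasepUpdateFun]; split_ifs <;> omega

lemma TasepState.succ_lt (x : TasepState N) (n : ℕ) (h : n + 1 < N) :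
    x.1 ⟨n + 1, h⟩ < x.1 ⟨n, Nat.lt_of_succ_lt h⟩ :=
  x.2 (Fin.mk_lt_mk.2 n.lt_succ_self)

/-- The configuration after a step of sequential TASEP driven by given bits. -/
def tasepUpdate (e : GTIndex N → Bool) (x : TasepState N) : TasepState N :=
  ⟨fun n => tasepUpdateFun e x.1 n.1 n.2, by
    cases N with
    | zero => exact fun a => a.elim0
    | succ N =>
      refine Fin.strictAnti_iff_succ_lt.2 fun i => ?_
      have h1 := le_tasepUpdateFun e x.1 i.1 (Nat.lt_succ_of_lt i.2)
      have h2 := x.succ_lt i.1 (Nat.succ_lt_succ i.2)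
      have h3 := bitStep_eq_or (e ⟨⟨i.1 + 1, Nat.succ_lt_succ i.2⟩, 0⟩)
      simp only [Fin.val_succ, Fin.val_castSucc, tasepUpdateFun]
      split_ifs <;> omega⟩

lemma tasepUpdate_apply (e : GTIndex N → Bool) (x : TasepState N) (n : Fin N) :
    (tasepUpdate e x).1 n = tasepNext (tasepUpdate e x).1 n (x.1 n) (e ⟨n, 0⟩) := by
  obtain ⟨_ | n, h⟩ := n <;> rfl

lemma tasepUpdate_eq_iff (e : GTIndex N → Bool) (x y : TasepState N) :
    tasepUpdate e x = y ↔ ∀ n, tasepNext y.1 n (x.1 n) (e ⟨n, 0⟩) = y.1 n := by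
  constructor
  · rintro rfl n
    exact (tasepUpdate_apply e x n).symm
  · intro h
    have hrow : ∀ n (hn : n < N), (tasepUpdate e x).1 ⟨n, hn⟩ = y.1 ⟨n, hn⟩ := fun n hn => by
      induction n with
      | zero => exact h ⟨0, hn⟩
      | succ n ih =>
        have := h ⟨n + 1, hn⟩
        rw [tasepUpdate_apply]
        simpa only [tasepNext, ih] using this
    exact Subtype.ext (funext fun n => hrow n.1 n.2)

lemma seqTasepFactor_eq (p : ℝ) (x y : TasepState N) (n : Fin N) :
    seqTasepFactor p x y n =
      ∑ c, if tasepNext y.1 n (x.1 n) c = y.1 n then bitWeight p c else 0 := by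
  obtain ⟨_ | n, h⟩ := n
  · exact oneStep_eq_sum _ _ _
  · simp only [seqTasepFactor, tasepNext]
    by_cases h1 : x.1 ⟨n + 1, h⟩ + 1 = y.1 ⟨n, Nat.lt_of_succ_lt h⟩
    · by_cases h2 : y.1 ⟨n + 1, h⟩ = x.1 ⟨n + 1, h⟩
      · simp [h1, h2, bitWeight]
      · simp [h1, h2, Ne.symm h2]
    · simp only [if_neg h1]
      exact oneStep_eq_sum _ _ _

/-- TASEP is driven by the bits of the whole pattern so that both chains share their randomness; the
bits off the left edge are unconstrained and sum to `1`. -/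
lemma seqTasepStep_eq_mapKernel (p : ℝ) : seqTasepStep N p = mapKernel tasepUpdate p := by
  funext x y
  have h : ∀ e : GTIndex N → Bool, tasepUpdate e x = y ↔
      ∀ b : GTIndex N, b.2 = 0 → tasepNext y.1 b.1 (x.1 b.1) (e b) = y.1 b.1 := fun e => by
    rw [tasepUpdate_eq_iff]
    refine ⟨fun h b hb => ?_, fun h n => h ⟨n, 0⟩ rfl⟩
    obtain ⟨n, i⟩ := b
    obtain rfl : i = 0 := hb
    exact h n
  rw [mapKernel, seqTasepStep]
  simp only [h]
  rw [sum_bitsWeight_forall p fun (b : GTIndex N) c =>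
    b.2 = 0 → tasepNext y.1 b.1 (x.1 b.1) c = y.1 b.1, Fintype.prod_sigma]
  refine Finset.prod_congr rfl fun n _ => ?_
  rw [seqTasepFactor_eq, Fin.prod_univ_succ]
  simp [Fin.succ_ne_zero, bitWeight]

lemma tasepUpdate_false : tasepUpdate (fun _ : GTIndex N => false) = id := by
  funext x
  refine (tasepUpdate_eq_iff _ x x).2 fun n => ?_
  obtain ⟨_ | n, h⟩ := n <;> simp [tasepNext, bitStep]

/-- The leftmost particles of a pattern are only influenced by each other. -/
lemma leftmost_gtUpdate (e : GTIndex N → Bool) (X : GT N) :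
    leftmost (gtUpdate e X) = tasepUpdate e (leftmost X) := by
  symm
  refine (tasepUpdate_eq_iff _ _ _).2 fun n => ?_
  change _ = (gtUpdate e X).1 n 0
  rw [gtUpdate_apply]
  obtain ⟨_ | n, h⟩ := n
  · simp only [tasepNext, nextPos, fits_elim0, if_true]
    rfl
  · have hX := (X.2 n h 0).1
    have hle := rowUpdate_eq_or e X n (Nat.lt_of_succ_lt h) 0
    -- The leftmost particle has no lower-left neighbour, so only the upper bound remains. By `hX`
    -- and `hle` its old position always satisfies it: pushing never occurs.
    have hf : ∀ a, Fits (rowBelow (gtUpdate e X) ⟨n + 1, h⟩) 0 a ↔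
        a < rowUpdate e X n (Nat.lt_of_succ_lt h) 0 := fun a =>
      ⟨fun hf => hf.1 0 rfl, fun hf => ⟨fun j hj => by
        rw [Fin.castSucc_eq_zero_iff.1 hj]; exact hf, fun j hj => absurd hj (Fin.succ_ne_zero j)⟩⟩
    change (if X.1 ⟨n + 1, h⟩ 0 + 1 = rowUpdate e X n (Nat.lt_of_succ_lt h) 0 then
      X.1 ⟨n + 1, h⟩ 0 else X.1 ⟨n + 1, h⟩ 0 + bitStep (e ⟨⟨n + 1, h⟩, 0⟩)) = _
    change X.1 ⟨n + 1, h⟩ 0 < X.1 ⟨n, Nat.lt_of_succ_lt h⟩ 0 at hX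
    simp only [nextPos, hf]
    split_ifs <;> omega

end Tasep

/-! ### The generator of TASEP -/

section Generator

variable {N : ℕ}

instance : Countable (TasepState N) := by unfold TasepState; infer_instance

lemma canJump_mk_succ_iff (x : TasepState N) (n : ℕ) (h : n + 1 < N) :
    CanJump x ⟨n + 1, h⟩ ↔ x.1 ⟨n + 1, h⟩ + 1 ≠ x.1 ⟨n, Nat.lt_of_succ_lt h⟩ := by
  refine ⟨fun hc => (hc _).symm, fun hne m hm => ?_⟩
  have h1 := x.succ_lt n h
  rcases lt_trichotomy m.1 n with hmn | hmn | hmn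
  · have := x.2 (show m < ⟨n, Nat.lt_of_succ_lt h⟩ from hmn)
    omega
  · exact hne (by rw [← hm, show m = ⟨n, Nat.lt_of_succ_lt h⟩ from Fin.ext hmn])
  · have := x.2.antitone (show (⟨n + 1, h⟩ : Fin N) ≤ m from hmn)
    omega

lemma canJump_mk_zero (x : TasepState N) (h : 0 < N) : CanJump x ⟨0, h⟩ := fun m hm => by
  have := x.2.antitone (show (⟨0, h⟩ : Fin N) ≤ m from Nat.zero_le _)
  omega

lemma tasepNext_false (y : Fin N → ℤ) (n : Fin N) (a : ℤ) : tasepNext y n a false = a := by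
  obtain ⟨_ | n, h⟩ := n <;> simp [tasepNext, bitStep]

-- When a single bit fires, the particles ahead have not moved, so the updated and the old
-- configuration impose the same exclusion rule.
open Classical in
lemma tasepUpdate_singleBit_zero (x : TasepState N) (n : Fin N) :
    tasepUpdate (singleBit (B := GTIndex N) ⟨n, 0⟩) x =
      if h : CanJump x n then jump x n h else x := by
  rw [tasepUpdate_eq_iff]
  intro m
  by_cases hmn : m = n
  · subst hmn
    have hb : singleBit (B := GTIndex N) ⟨m, 0⟩ ⟨m, 0⟩ = true := by simp [singleBit]
    rw [hb]
    obtain ⟨_ | k, h⟩ := m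
    · rw [dif_pos (canJump_mk_zero x h)]
      simp [tasepNext, jump, bitStep]
    · by_cases hc : CanJump x ⟨k + 1, h⟩
      · rw [dif_pos hc]
        have := (canJump_mk_succ_iff x k h).1 hc
        simp [tasepNext, jump, bitStep, this]
      · rw [dif_neg hc]
        rw [canJump_mk_succ_iff, not_not] at hc
        simp [tasepNext, hc]
  · have hb : singleBit (B := GTIndex N) ⟨n, 0⟩ ⟨m, 0⟩ = false := by
      rw [singleBit, Function.update_of_ne]
      exact fun h => hmn (congrArg Sigma.fst h)
    rw [hb, tasepNext_false]
    split_ifs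
    · exact (Function.update_of_ne hmn _ _).symm
    · rfl

lemma tasepUpdate_singleBit_succ (x : TasepState N) (n : Fin N) (i : Fin n.1) :
    tasepUpdate (singleBit (B := GTIndex N) ⟨n, i.succ⟩) x = x := by
  refine (tasepUpdate_eq_iff _ _ _).2 fun m => ?_
  have hb : singleBit (B := GTIndex N) ⟨n, i.succ⟩ ⟨m, 0⟩ = false := by
    rw [singleBit, Function.update_of_ne]
    intro h
    obtain ⟨rfl, h⟩ := Sigma.mk.inj_iff.1 h
    exact Fin.succ_ne_zero i (eq_of_heq h).symm
  rw [hb, tasepNext_false]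

open Classical in
lemma mapGen_tasepUpdate_dirac (x : TasepState N) :
    mapGen (B := GTIndex N) tasepUpdate (dirac x) =
      ∑ n, if h : CanJump x n then dirac (jump x n h) - dirac x else 0 := by
  rw [mapGen, sum_apply, Fintype.sum_sigma]
  refine Finset.sum_congr rfl fun n _ => ?_
  rw [Fin.sum_univ_succ]
  simp only [sub_apply, L1.map_dirac, tasepUpdate_singleBit_succ, tasepUpdate_singleBit_zero,
    tasepUpdate_false, id, sub_self, Finset.sum_const_zero, add_zero]
  split_ifs
  · rfl
  · exact sub_self _

open Classical in
lemma mat_mapGen_pow (k : ℕ) (x y : TasepState N) :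
    mat (mapGen (B := GTIndex N) tasepUpdate ^ k) x y =
      ((tasepGenerator N)^[k] fun z => if z = y then 1 else 0) x := by
  induction k generalizing x with
  | zero => rw [pow_zero, mat_one]; rfl
  | succ k ih =>
    rw [Function.iterate_succ_apply', tasepGenerator]
    simp only [← ih]
    -- The operator acts on measures and `tasepGenerator` on functions. Splitting off the factor
    -- that acts first on `dirac x` matches the outermost application of the generator.
    rw [pow_succ]
    change L1.eval y ((mapGen (B := GTIndex N) tasepUpdate ^ k)
      (mapGen (B := GTIndex N) tasepUpdate (dirac x))) = _
    rw [mapGen_tasepUpdate_dirac, map_sum, map_sum]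
    refine Finset.sum_congr rfl fun n _ => ?_
    split_ifs
    · rw [map_sub, map_sub]; rfl
    · rw [map_zero, map_zero]

lemma tasepTransition_eq (t : ℝ≥0) (x y : TasepState N) :
    tasepTransition N t x y = mat (mapSemigroup (B := GTIndex N) tasepUpdate t) x y := by
  rw [mat_mapSemigroup, tasepTransition]
  simp only [mat_mapGen_pow]

end Generator

/-! ### The continuous-time intertwined chain -/

section Continuous

variable {N : ℕ}

lemma tendsto_kernelPow_gtStep (t : ℝ≥0) (X Y : GT N) :
    Tendsto (fun p : ℝ => kernelPow (gtStep N p) ⌊(t : ℝ) / p⌋₊ X Y) (𝓝[>] 0)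
      (𝓝 (mat (mapSemigroup gtUpdate t) X Y)) :=
  -- The random-mapping form of `gtStep` is available for `p` in `[0,1]`, which holds eventually as
  -- `p ↓ 0`.
  (tendsto_kernelPow_mapKernel gtUpdate_false t X Y).congr'
    (eventually_mem_unitInterval.mono fun _ hp => by
      beta_reduce; rw [gtStep_eq_mapKernel hp.1 hp.2])

lemma gtTransition_eq (t : ℝ≥0) : gtTransition N t = mat (mapSemigroup gtUpdate t) := by
  funext X Y
  exact (tendsto_kernelPow_gtStep t X Y).limUnder_eq

lemma tasepTransition_eq_mat (t : ℝ≥0) :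
    tasepTransition N t = mat (mapSemigroup (B := GTIndex N) tasepUpdate t) := by
  funext x y
  exact tasepTransition_eq t x y

lemma projectsTo_gtTransition (t : ℝ≥0) :
    ProjectsTo leftmost (gtTransition N t) (tasepTransition N t) := by
  rw [gtTransition_eq, tasepTransition_eq_mat]
  exact projectsTo_mat
    (map_comp_mapSemigroup leftmost_gtUpdate gtUpdate_false tasepUpdate_false t)

lemma isTransitionFunction_gtTransition : IsTransitionFunction (gtTransition N) := by
  rw [funext gtTransition_eq]
  exact isTransitionFunction_mapSemigroup gtUpdate_false

lemma isTransitionFunction_tasepTransition : IsTransitionFunction (tasepTransition N) := by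
  rw [funext tasepTransition_eq_mat]
  exact isTransitionFunction_mapSemigroup tasepUpdate_false

end Continuous

end GTTasep

end

theorem mainTheorem1 (N : ℕ) :
    -- discrete time
    (∀ p : ℝ, 0 ≤ p → p ≤ 1 →
      GTTasep.IsStochastic (GTTasep.gtStep N p) ∧
      GTTasep.IsStochastic (GTTasep.seqTasepStep N p) ∧
      GTTasep.ProjectsTo GTTasep.leftmost (GTTasep.gtStep N p) (GTTasep.seqTasepStep N p) ∧
      ∀ (Ω : Type*) [MeasurableSpace Ω] (μ : Measure Ω) [IsProbabilityMeasure μ]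
        (X : ℕ → Ω → GTTasep.GT N),
        GTTasep.IsMarkovChain μ (GTTasep.kernelPow (GTTasep.gtStep N p)) X →
        GTTasep.IsMarkovChain μ (GTTasep.kernelPow (GTTasep.seqTasepStep N p))
          (fun k ω => GTTasep.leftmost (X k ω))) ∧
    -- the limits of small jump probability and large time
    (∀ (t : ℝ≥0) (X Y : GTTasep.GT N),
      Tendsto (fun p : ℝ => GTTasep.kernelPow (GTTasep.gtStep N p) ⌊(t : ℝ) / p⌋₊ X Y)
        (𝓝[>] 0) (𝓝 (GTTasep.gtTransition N t X Y))) ∧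
    (∀ (t : ℝ≥0) (x y : GTTasep.TasepState N),
      Tendsto (fun p : ℝ => GTTasep.kernelPow (GTTasep.seqTasepStep N p) ⌊(t : ℝ) / p⌋₊ x y)
        (𝓝[>] 0) (𝓝 (GTTasep.tasepTransition N t x y))) ∧
    -- continuous time
    GTTasep.IsTransitionFunction (GTTasep.gtTransition N) ∧
    GTTasep.IsTransitionFunction (GTTasep.tasepTransition N) ∧
    (∀ t : ℝ≥0, GTTasep.ProjectsTo GTTasep.leftmost
      (GTTasep.gtTransition N t) (GTTasep.tasepTransition N t)) ∧
    ∀ (Ω : Type*) [MeasurableSpace Ω] (μ : Measure Ω) [IsProbabilityMeasure μ]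
      (X : ℝ≥0 → Ω → GTTasep.GT N),
      GTTasep.IsMarkovChain μ (GTTasep.gtTransition N) X →
      GTTasep.IsMarkovChain μ (GTTasep.tasepTransition N)
        (fun t ω => GTTasep.leftmost (X t ω)) ∧
      ∀ ω, GTTasep.IsCadlagPath (fun t => X t ω) →
        GTTasep.IsCadlagPath (fun t => GTTasep.leftmost (X t ω)) := by
  refine ⟨fun p h0 h1 => ?_, fun t X Y => ?_, fun t x y => ?_,
    GTTasep.isTransitionFunction_gtTransition, GTTasep.isTransitionFunction_tasepTransition,
    GTTasep.projectsTo_gtTransition, fun Ω _ μ _ X hX =>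
      ⟨hX.project GTTasep.projectsTo_gtTransition, fun ω hω => hω.comp GTTasep.leftmost⟩⟩
  · rw [GTTasep.gtStep_eq_mapKernel h0 h1, GTTasep.seqTasepStep_eq_mapKernel]
    exact ⟨GTTasep.isStochastic_mapKernel h0 h1, GTTasep.isStochastic_mapKernel h0 h1,
      GTTasep.projectsTo_mapKernel GTTasep.leftmost_gtUpdate p, fun Ω _ μ _ X hX =>
        hX.project (GTTasep.projectsTo_kernelPow_mapKernel GTTasep.leftmost_gtUpdate p)⟩
  · rw [GTTasep.gtTransition_eq]
    exact GTTasep.tendsto_kernelPow_gtStep t X Y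
  · simp only [GTTasep.tasepTransition_eq, GTTasep.seqTasepStep_eq_mapKernel]
    exact GTTasep.tendsto_kernelPow_mapKernel GTTasep.tasepUpdate_false t x y
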